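/- Let $H\in(1/2,1)$. Let $\{Y(t)\}_{t\in\mathbf Z}$ be a real second-order stationary process with spectral density $h$ in normalised frequency, i.e. $\operatorname{Cov}(Y(t),Y(t+k))=\int_{-1/2}^{1/2}e^{2\pi i k x}h(x)\,dx$ for all $k\in\mathbf Z$. Assume that $h>0$ on $[-1/2,1/2]$, that $h$ is three times continuously differentiable on $[-1/2,1/2]$ (one-sidedly at the endpoints), and that its one-sided derivatives at the endpoints agree, $h'(-1/2)=h'(1/2)$ (so that the $1$-periodic extension of $h$ is continuously differentiable). Let $X=(1-B)^{-(H-1/2)}Y$ be the fractionally differenced process driven by $Y$, where $B$ is the backshift operator; that is, for every $t$, $$X(t)=\sum_{j=0}^\infty \frac{\Gamma(j+H-\tfrac12)}{\Gamma(H-\tfrac12)\,\Gamma(j+1)}\,Y(t-j)\qquad\text{in mean square.}$$ Let $$\gamma_H^*(n)=\frac{\mathcal V}{2}\left(|n+1|^{2H}+|n-1|^{2H}-2|n|^{2H}\right)$$ be the autocovariance function of the fractional Gaussian noise with Hurst parameter $H$ and variance $\mathcal V>0$, where $\mathcal V$ is chosen so that $c_f=c_f^*$, with $$c_f=(2\pi)^{1-2H}h(0),\qquad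 c_f^*=\mathcal V\,(2\pi)^{2-2H}\,\pi^{-1}H\,\Gamma(2H)\sin(H\pi)$$ (these are the constants in $f_H(x)\sim c_f|x|^{-(2H-1)}$ and $f_H^*(x)\sim c_f^*|x|^{-(2H-1)}$ as $x\to0$, for the spectral densities $f_H$ of $X$ and $f_H^*$ of the fractional Gaussian noise). Then $X$ is second-order stationary, and its autocovariance function $\gamma_H(n)=\operatorname{Cov}(X(0),X(n))$ satisfies $$\gamma_H(n)=\gamma_H^*(n)+O(n^{2H-4})\qquad(n\to\infty).$$ -/

import Mathlib

open MeasureTheory ProbabilityTheory Filter Topology Asymptotics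

noncomputable section

namespace FracDiff

/-- A real process indexed by the integers is second-order stationary: square integrable, with
constant mean, and with covariances that depend on the lag only. -/
structure SecondOrderStationary {Ω : Type*} [MeasurableSpace Ω] (X : ℤ → Ω → ℝ)
    (P : Measure Ω) : Prop where
  memLp : ∀ t, MemLp (X t) 2 P
  mean_eq : ∀ s t, ∫ ω, X s ω ∂P = ∫ ω, X t ω ∂P
  cov_eq : ∀ s t k, covariance (X s) (X (s + k)) P = covariance (X t) (X (t + k)) P

/-- The autocovariance function `γ(k) = E[(X(0) - μ)(X(k) - μ)]` of a second-order stationary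
process. -/
def acvf {Ω : Type*} [MeasurableSpace Ω] (X : ℤ → Ω → ℝ) (P : Measure Ω) (k : ℤ) : ℝ :=
  covariance (X 0) (X k) P

/-- `f` is a spectral density, in normalised frequency `x ∈ [-1/2, 1/2]`, of the autocovariance
function `γ`: it is nonnegative and integrable, and
`γ(k) = ∫_{-1/2}^{1/2} exp(2πikx) f(x) dx` for all integers `k`. -/
structure HasSpectralDensity (γ : ℤ → ℝ) (f : ℝ → ℝ) : Prop where
  nonneg : ∀ x ∈ Set.Icc (-1 / 2 : ℝ) (1 / 2), 0 ≤ f x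
  integrable : IntervalIntegrable f volume (-1 / 2) (1 / 2)
  eq_integral : ∀ k : ℤ, (γ k : ℂ) =
    ∫ x in (-1 / 2 : ℝ)..(1 / 2), Complex.exp (2 * Real.pi * Complex.I * k * x) * (f x : ℂ)

/-- The coefficient `Γ(j - d) / (Γ(-d) Γ(j + 1))` of `B ^ j` in `(1 - B) ^ d`
(for `d` not a nonnegative integer). -/
def diffCoeff (d : ℝ) (j : ℕ) : ℝ :=
  Real.Gamma (j - d) / (Real.Gamma (-d) * Real.Gamma (j + 1))

/-- `X = (1 - B) ^ d Y`, where `B` is the backshift operator: for every `t`, the random variable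
`X t` is the mean-square limit of the partial sums of `∑ j, diffCoeff d j * Y (t - j)`. -/
def IsFractionalDifference {Ω : Type*} [MeasurableSpace Ω] (d : ℝ) (Y X : ℤ → Ω → ℝ)
    (P : Measure Ω) : Prop :=
  ∀ t : ℤ, MemLp (X t) 2 P ∧
    Tendsto (fun N : ℕ =>
      eLpNorm (fun ω => X t ω - ∑ j ∈ Finset.range N, diffCoeff d j * Y (t - j) ω) 2 P)
      atTop (𝓝 0)

/-- The autocovariance function of fractional Gaussian noise with Hurst parameter `H` and
variance `V`; its variance time function is `V * m ^ (2 * H)`. -/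
def fgnACVF (H V : ℝ) (n : ℤ) : ℝ :=
  V / 2 * (|(n : ℝ) + 1| ^ (2 * H) + |(n : ℝ) - 1| ^ (2 * H) - 2 * |(n : ℝ)| ^ (2 * H))

/-- The constant in `f_H(x) ~ c_f |x| ^ (-(2H - 1))` as `x → 0`, where
`f_H(x) = h(x) |2 sin πx| ^ (-(2H - 1))` is the spectral density of the fractionally differenced
process driven by a process with spectral density `h`. -/
def cf (H : ℝ) (h : ℝ → ℝ) : ℝ :=
  (2 * Real.pi) ^ (1 - 2 * H) * h 0

/-- The constant in `f*_H(x) ~ c_f* |x| ^ (-(2H - 1))` as `x → 0`, where `f*_H` is the spectral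
density of fractional Gaussian noise with Hurst parameter `H` and variance `V`. -/
def cfStar (H V : ℝ) : ℝ :=
  V * (2 * Real.pi) ^ (2 - 2 * H) *
    (Real.pi⁻¹ * H * Real.Gamma (2 * H) * Real.sin (H * Real.pi))

end FracDiff

end

/-!
Write `d = H - 1/2`. The autocovariance of `X` is the convolution of `γ_Y` with the autocovariance
`g` of the ARFIMA(0, `d`, 0) process `(1 - B)^(-d) ε`, where `ε` is white noise.

* Since `h` is even, `h` and its second derivative automatically agree at the two endpoints, and the
  first derivative does by assumption. Three integrations by parts and the identity of Parseval give
  `∑ (|k|³ |γ_Y(k)|)² < ∞`; in particular `|k|³ |γ_Y(k)|` is bounded and `∑ k² |γ_Y(k)| < ∞`.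
* By the beta integral, `g(x)` is a multiple of the Laplace transform of `(2 sinh (u/2))^(-2d)`.
  As `(2 sinh (u/2))^(-2d) = u^(-2d) (1 + O(u²))`, this gives `g(n) = κ n^(2d-1) + O(n^(2d-3))`.
  The second difference of `e^(-xu)` in `x` at step `m` is `e^(-(x-m)u) (1 - e^(-mu))²`, and
  `1 - e^(-mu) ≤ mu`, so `g(n+m) + g(n-m) - 2g(n) = O(m² n^(2d-3))` for `0 ≤ m ≤ n/2`.
* As `γ_Y` is even, `∑ γ_Y(m) g(n-m) - (∑ γ_Y(m)) g(n)` involves only symmetric second differences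
  of `g`; the terms with `|m| ≤ n/2` are controlled by the second moment of `γ_Y`, the others by its
  cubic decay. Hence `γ_X(n) = h(0) κ n^(2d-1) + O(n^(2d-3))`.
* The fractional Gaussian noise has `γ*(n) = V H (2H-1) n^(2H-2) + O(n^(2H-4))`, and `c_f = c_f*`
  says `h(0) κ = V H (2H-1)` by the reflection formula for `Γ`.
-/

namespace FracDiff

section FourierCoefficients

variable {a b : ℝ} {f g : ℝ → ℂ}

lemma memLp_restrict_Ioc_of_continuousOn (hf : ContinuousOn f (Set.Icc a b)) (p : ENNReal) :
    MemLp f p (volume.restrict (Set.Ioc a b)) := by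
  obtain ⟨C, hC⟩ := isCompact_Icc.exists_bound_of_continuousOn hf
  refine MemLp.of_bound ((hf.mono Set.Ioc_subset_Icc_self).aestronglyMeasurable
    measurableSet_Ioc) C ?_
  filter_upwards [ae_restrict_mem measurableSet_Ioc] with x hx using
    hC x (Set.Ioc_subset_Icc_self hx)

lemma summable_sq_norm_fourierCoeffOn (hab : a < b) (hf : ContinuousOn f (Set.Icc a b)) :
    Summable fun k => ‖fourierCoeffOn hab f k‖ ^ 2 :=
  (hasSum_sq_fourierCoeffOn hab (memLp_restrict_Ioc_of_continuousOn hf 2)).summable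

lemma fourierCoeffOn_sub (hab : a < b) (hf : IntervalIntegrable f volume a b)
    (hg : IntervalIntegrable g volume a b) (k : ℤ) :
    fourierCoeffOn hab (f - g) k = fourierCoeffOn hab f k - fourierCoeffOn hab g k := by
  have hcont : ContinuousOn (fun x : ℝ => fourier (-k) (x : AddCircle (b - a))) (Set.uIcc a b) :=
    ((map_continuous (fourier (-k))).comp (AddCircle.continuous_mk' _)).continuousOn
  simp only [fourierCoeffOn_eq_integral, Pi.sub_apply, smul_eq_mul, mul_sub]
  rw [intervalIntegral.integral_sub (hf.continuousOn_mul hcont) (hg.continuousOn_mul hcont),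
    smul_sub]

lemma fourierCoeffOn_comp_neg (hab : a < b) (hneg : -b = a) (f : ℝ → ℂ) (k : ℤ) :
    fourierCoeffOn hab (fun x => f (-x)) k = fourierCoeffOn hab f (-k) := by
  subst hneg
  have hreflect := intervalIntegral.integral_comp_neg (a := -b) (b := b)
    (fun x => fourier (- -k) (x : AddCircle (b - -b)) • f x)
  simp only [neg_neg] at hreflect
  rw [fourierCoeffOn_eq_integral, fourierCoeffOn_eq_integral, neg_neg, ← hreflect]
  simp only [fourier_coe_apply, Int.cast_neg, Complex.ofReal_neg, mul_neg, neg_mul]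

lemma eqOn_of_fourierCoeffOn_eq (hab : a < b) (hf : ContinuousOn f (Set.Icc a b))
    (hg : ContinuousOn g (Set.Icc a b)) (hfg : fourierCoeffOn hab f = fourierCoeffOn hab g) :
    Set.EqOn f g (Set.Icc a b) := by
  have hcoeff : fourierCoeffOn hab (f - g) = 0 := by
    funext k
    rw [fourierCoeffOn_sub hab (hf.intervalIntegrable_of_Icc hab.le)
      (hg.intervalIntegrable_of_Icc hab.le), hfg, sub_self, Pi.zero_apply]
  have hparseval := hasSum_sq_fourierCoeffOn hab
    (memLp_restrict_Ioc_of_continuousOn (hf.sub hg) 2)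
  simp only [hcoeff, Pi.zero_apply, norm_zero, ne_eq, OfNat.ofNat_ne_zero, not_false_eq_true,
    zero_pow] at hparseval
  have hzero : ∫ x in Set.Ioc a b, ‖(f - g) x‖ ^ 2 = 0 := by
    have := hparseval.unique hasSum_zero
    rwa [smul_eq_mul, mul_eq_zero_iff_left (by simp [sub_ne_zero, hab.ne']),
      intervalIntegral.integral_of_le hab.le] at this
  rw [setIntegral_eq_zero_iff_of_nonneg_ae (ae_of_all _ fun x => by positivity)
    (ContinuousOn.integrableOn_Icc (by fun_prop) |>.mono_set Set.Ioc_subset_Icc_self)] at hzero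
  refine Measure.eqOn_Icc_of_ae_eq volume hab.ne ?_ hf hg
  rw [← restrict_Ioc_eq_restrict_Icc]
  filter_upwards [hzero] with x hx
  simpa [sub_eq_zero] using hx

lemma fourierCoeffOn_derivWithin (hab : a < b) (hf : ContDiffOn ℝ 1 f (Set.Icc a b))
    (hper : f a = f b) (k : ℤ) :
    fourierCoeffOn hab (derivWithin f (Set.Icc a b)) k =
      2 * Real.pi * Complex.I * k / (b - a) * fourierCoeffOn hab f k := by
  have hderiv : ∀ x ∈ Set.Ioo a b, HasDerivAt f (derivWithin f (Set.Icc a b) x) x := fun x hx =>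
    ((hf.differentiableOn one_ne_zero x (Set.Ioo_subset_Icc_self hx)).hasDerivWithinAt).hasDerivAt
      (Icc_mem_nhds hx.1 hx.2)
  have hint : IntervalIntegrable (derivWithin f (Set.Icc a b)) volume a b :=
    (hf.continuousOn_derivWithin (uniqueDiffOn_Icc hab) le_rfl).intervalIntegrable_of_Icc hab.le
  have hba : (b : ℂ) - a ≠ 0 := by exact_mod_cast (sub_pos.2 hab).ne'
  rcases eq_or_ne k 0 with rfl | hk
  · rw [fourierCoeffOn_eq_integral]
    simp [intervalIntegral.integral_eq_sub_of_hasDerivAt_of_le hab.le hf.continuousOn hderiv hint,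
      hper]
  · have hkC : (k : ℂ) ≠ 0 := by exact_mod_cast hk
    have hpi : (Real.pi : ℂ) ≠ 0 := by exact_mod_cast Real.pi_ne_zero
    have hparts := fourierCoeffOn_of_hasDerivAt_Ioo hab hk
      (by rw [Set.uIcc_of_le hab.le]; exact hf.continuousOn)
      (by rwa [min_eq_left hab.le, max_eq_right hab.le]) hint
    rw [hparts, hper]
    field_simp
    ring

lemma fourierCoeffOn_iteratedDerivWithin (hab : a < b) {n : ℕ}
    (hf : ContDiffOn ℝ n f (Set.Icc a b))
    (hper : ∀ j < n, iteratedDerivWithin j f (Set.Icc a b) a =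
      iteratedDerivWithin j f (Set.Icc a b) b) (k : ℤ) :
    fourierCoeffOn hab (iteratedDerivWithin n f (Set.Icc a b)) k =
      (2 * Real.pi * Complex.I * k / (b - a)) ^ n * fourierCoeffOn hab f k := by
  induction n with
  | zero => simp
  | succ n ih =>
    have hsmooth : ContDiffOn ℝ 1 (iteratedDerivWithin n f (Set.Icc a b)) (Set.Icc a b) :=
      ((contDiffOn_nat_succ_iff_contDiffOn_one_iteratedDerivWithin (uniqueDiffOn_Icc hab)).1
        (by exact_mod_cast hf)).2
    rw [iteratedDerivWithin_succ, fourierCoeffOn_derivWithin hab hsmooth (hper n n.lt_succ_self),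
      ih (hf.of_le (by exact_mod_cast n.le_succ)) fun j hj => hper j (hj.trans n.lt_succ_self),
      pow_succ']
    ring

lemma summable_sq_pow_mul_norm_fourierCoeffOn (hab : a < b) {n : ℕ}
    (hf : ContDiffOn ℝ n f (Set.Icc a b))
    (hper : ∀ j < n, iteratedDerivWithin j f (Set.Icc a b) a =
      iteratedDerivWithin j f (Set.Icc a b) b) :
    Summable fun k : ℤ => (|(k : ℝ)| ^ n * ‖fourierCoeffOn hab f k‖) ^ 2 := by
  have hba : 0 < b - a := sub_pos.2 hab
  have hderiv := (summable_sq_norm_fourierCoeffOn hab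
    (hf.continuousOn_iteratedDerivWithin le_rfl (uniqueDiffOn_Icc hab))).mul_left
      ((((b - a) / (2 * Real.pi)) ^ n) ^ 2)
  refine hderiv.congr fun k => ?_
  have hnorm : ‖(2 * Real.pi * Complex.I * k / (b - a) : ℂ)‖ =
      2 * Real.pi / (b - a) * |(k : ℝ)| := by
    rw [← Complex.ofReal_sub, norm_div, Complex.norm_real, Real.norm_of_nonneg hba.le]
    simp [abs_of_pos Real.pi_pos]
    ring
  rw [fourierCoeffOn_iteratedDerivWithin hab hf hper, norm_mul, norm_pow, hnorm, ← mul_pow,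
    ← mul_assoc, ← mul_pow, ← mul_assoc]
  congr 3
  field_simp

lemma hasSum_fourierCoeffOn (hab : a < b) (hf : ContinuousOn f (Set.Icc a b)) (hper : f a = f b)
    (hsum : Summable (fourierCoeffOn hab f)) {x : ℝ} (hx : x ∈ Set.Ico a b) :
    HasSum (fun k : ℤ => fourierCoeffOn hab f k *
      Complex.exp (2 * Real.pi * Complex.I * k * x / (b - a))) (f x) := by
  obtain ⟨T, rfl⟩ : ∃ T, b = a + T := ⟨b - a, by ring⟩
  have hT : Fact (0 < T) := ⟨by linarith⟩
  let F : C(AddCircle T, ℂ) := ⟨AddCircle.liftIco T a f, AddCircle.liftIco_continuous hper hf⟩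
  have hcoeff : fourierCoeff F = fourierCoeffOn hab f := funext (fourierCoeff_liftIco_eq f)
  have hpointwise := has_pointwise_sum_fourier_series_of_summable (f := F)
    (by rwa [hcoeff]) (x : AddCircle T)
  have hFx : F (x : AddCircle T) = f x := AddCircle.liftIco_coe_apply hx
  rw [hFx, hcoeff] at hpointwise
  simpa [fourier_coe_apply] using hpointwise

end FourierCoefficients

section Summability

variable {u : ℤ → ℝ} {n : ℕ}

lemma summable_pow_mul_abs_of_sq (hu : Summable fun k : ℤ => (|(k : ℝ)| ^ (n + 1) * |u k|) ^ 2) :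
    Summable fun k : ℤ => |(k : ℝ)| ^ n * |u k| := by
  have hsq : Summable fun k : ℤ => 1 / (k : ℝ) ^ 2 :=
    Real.summable_one_div_int_pow.mpr one_lt_two
  refine Summable.of_norm_bounded_eventually (hsq.add hu) ?_
  filter_upwards [(Set.finite_singleton (0 : ℤ)).compl_mem_cofinite] with k hk
  have hkpos : 0 < |(k : ℝ)| := abs_pos.2 (Int.cast_ne_zero.2 hk)
  have hamgm := two_mul_le_add_sq (1 / |(k : ℝ)|) (|(k : ℝ)| ^ (n + 1) * |u k|)
  have hprod : 1 / |(k : ℝ)| * (|(k : ℝ)| ^ (n + 1) * |u k|) = |(k : ℝ)| ^ n * |u k| := by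
    rw [pow_succ]
    field_simp
  have hnonneg : 0 ≤ |(k : ℝ)| ^ n * |u k| := by positivity
  rw [mul_assoc, hprod, div_pow, one_pow, sq_abs] at hamgm
  rw [Real.norm_of_nonneg hnonneg]
  linarith

lemma summable_abs_of_summable_pow_mul (hu : Summable fun k : ℤ => |(k : ℝ)| ^ n * |u k|) :
    Summable fun k => |u k| := by
  refine Summable.of_norm_bounded_eventually hu ?_
  filter_upwards [(Set.finite_singleton (0 : ℤ)).compl_mem_cofinite] with k hk
  rw [Real.norm_eq_abs, abs_abs]
  have hone : (1 : ℝ) ≤ |(k : ℝ)| := by exact_mod_cast Int.one_le_abs hk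
  exact le_mul_of_one_le_left (abs_nonneg _) (one_le_pow₀ hone)

lemma exists_abs_le_of_summable_sq {ι : Type*} {v : ι → ℝ} (hv : Summable fun i => v i ^ 2) :
    ∃ C, ∀ i, |v i| ≤ C :=
  ⟨√(∑' i, v i ^ 2), fun i => Real.abs_le_sqrt (hv.le_tsum i fun _ _ => sq_nonneg _)⟩

end Summability

section SpectralDensity

namespace HasSpectralDensity

variable {γ : ℤ → ℝ} {h : ℝ → ℝ}

lemma fourierCoeffOn_eq (hγ : HasSpectralDensity γ h) (hab : (-1 / 2 : ℝ) < 1 / 2) (k : ℤ) :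
    fourierCoeffOn hab (fun x => (h x : ℂ)) k = γ (-k) := by
  rw [hγ.eq_integral, fourierCoeffOn_eq_integral]
  norm_num [fourier_coe_apply]
  simp [← Complex.exp_conj, Complex.conj_ofNat]

lemma acvf_neg (hγ : HasSpectralDensity γ h) (k : ℤ) : γ (-k) = γ k := by
  have hconj : (starRingEnd ℂ) (γ k) = γ (-k) := by
    rw [hγ.eq_integral, hγ.eq_integral, ← intervalIntegral.intervalIntegral_conj]
    simp [← Complex.exp_conj, Complex.conj_ofNat]
  exact_mod_cast hconj.symm.trans (Complex.conj_ofReal _)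

lemma eqOn_comp_neg (hγ : HasSpectralDensity γ h)
    (hh : ContinuousOn h (Set.Icc (-1 / 2) (1 / 2))) :
    Set.EqOn (fun x => h (-x)) h (Set.Icc (-1 / 2) (1 / 2)) := by
  have hab : (-1 / 2 : ℝ) < 1 / 2 := by norm_num
  have hC : ContinuousOn (fun x => (h x : ℂ)) (Set.Icc (-1 / 2) (1 / 2)) :=
    Complex.continuous_ofReal.comp_continuousOn hh
  have hCneg : ContinuousOn (fun x => (h (-x) : ℂ)) (Set.Icc (-1 / 2) (1 / 2)) :=
    hC.comp continuous_neg.continuousOn fun x hx => by constructor <;> linarith [hx.1, hx.2]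
  have heq := eqOn_of_fourierCoeffOn_eq hab hCneg hC <| funext fun k => by
    rw [fourierCoeffOn_comp_neg hab (by norm_num) (fun x => (h x : ℂ)), hγ.fourierCoeffOn_eq,
      hγ.fourierCoeffOn_eq, hγ.acvf_neg]
  exact fun x hx => Complex.ofReal_injective (heq hx)

lemma iteratedDerivWithin_two_endpoints (hγ : HasSpectralDensity γ h)
    (hh : ContinuousOn h (Set.Icc (-1 / 2) (1 / 2))) :
    iteratedDerivWithin 2 (fun x => (h x : ℂ)) (Set.Icc (-1 / 2) (1 / 2)) (-1 / 2) =
      iteratedDerivWithin 2 (fun x => (h x : ℂ)) (Set.Icc (-1 / 2) (1 / 2)) (1 / 2) := by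
  have heven : Set.EqOn (fun x => (h (-x) : ℂ)) (fun x => (h x : ℂ))
      (Set.Icc (-1 / 2) (1 / 2)) := fun x hx => congrArg Complex.ofReal (hγ.eqOn_comp_neg hh hx)
  have hmem : (1 / 2 : ℝ) ∈ Set.Icc (-1 / 2 : ℝ) (1 / 2) := ⟨by norm_num, le_rfl⟩
  rw [← iteratedDerivWithin_congr heven hmem,
    iteratedDerivWithin_comp_neg (f := fun x => (h x : ℂ))]
  norm_num [neg_div]

lemma summable_sq_cube_mul_abs (hγ : HasSpectralDensity γ h)
    (hh : ContDiffOn ℝ 3 h (Set.Icc (-1 / 2) (1 / 2)))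
    (hmatch : derivWithin h (Set.Icc (-1 / 2) (1 / 2)) (-1 / 2) =
      derivWithin h (Set.Icc (-1 / 2) (1 / 2)) (1 / 2)) :
    Summable fun k : ℤ => (|(k : ℝ)| ^ 3 * |γ k|) ^ 2 := by
  have hab : (-1 / 2 : ℝ) < 1 / 2 := by norm_num
  have hC : ContDiffOn ℝ 3 (fun x => (h x : ℂ)) (Set.Icc (-1 / 2) (1 / 2)) :=
    Complex.ofRealCLM.contDiff.comp_contDiffOn hh
  have hderiv : ∀ x ∈ Set.Icc (-1 / 2 : ℝ) (1 / 2),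
      derivWithin (fun x => (h x : ℂ)) (Set.Icc (-1 / 2) (1 / 2)) x =
        derivWithin h (Set.Icc (-1 / 2) (1 / 2)) x := fun x hx =>
    (hh.differentiableOn (by norm_num) x hx).hasDerivWithinAt.ofReal_comp.derivWithin
      (uniqueDiffOn_Icc hab x hx)
  have hper : ∀ j < 3, iteratedDerivWithin j (fun x => (h x : ℂ)) (Set.Icc (-1 / 2) (1 / 2))
      (-1 / 2) = iteratedDerivWithin j (fun x => (h x : ℂ)) (Set.Icc (-1 / 2) (1 / 2)) (1 / 2) := by
    intro j hj
    interval_cases j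
    · simpa [neg_div] using hγ.eqOn_comp_neg hh.continuousOn (Set.right_mem_Icc.2 hab.le)
    · rw [iteratedDerivWithin_one, hderiv _ (Set.left_mem_Icc.2 hab.le),
        hderiv _ (Set.right_mem_Icc.2 hab.le), hmatch]
    · exact hγ.iteratedDerivWithin_two_endpoints hh.continuousOn
  refine (summable_sq_pow_mul_norm_fourierCoeffOn hab hC hper).congr fun k => ?_
  rw [hγ.fourierCoeffOn_eq, hγ.acvf_neg, Complex.norm_real, Real.norm_eq_abs]

lemma hasSum (hγ : HasSpectralDensity γ h) (hh : ContinuousOn h (Set.Icc (-1 / 2) (1 / 2)))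
    (hsum : Summable γ) : HasSum γ (h 0) := by
  have hab : (-1 / 2 : ℝ) < 1 / 2 := by norm_num
  have hcoeff : fourierCoeffOn hab (fun x => (h x : ℂ)) = fun k => (γ k : ℂ) :=
    funext fun k => by rw [hγ.fourierCoeffOn_eq hab, hγ.acvf_neg]
  have hper : h (-1 / 2) = h (1 / 2) := by
    simpa [neg_div] using hγ.eqOn_comp_neg hh (Set.right_mem_Icc.2 hab.le)
  have hseries := hasSum_fourierCoeffOn hab (f := fun x => (h x : ℂ))
    (Complex.continuous_ofReal.comp_continuousOn hh) (congrArg Complex.ofReal hper)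
    (hcoeff ▸ Complex.summable_ofReal.2 hsum) (x := 0) ⟨by norm_num, by norm_num⟩
  rw [hcoeff] at hseries
  exact_mod_cast by simpa using hseries

end HasSpectralDensity

end SpectralDensity

section LaplaceTransform

/-- The Laplace transform of a function on the positive half-line; at a point where the integrand
is not integrable the value is `0`. -/
noncomputable def laplaceTransform (K : ℝ → ℝ) (x : ℝ) : ℝ :=
  ∫ u in Set.Ioi (0 : ℝ), Real.exp (-(x * u)) * K u

variable {K : ℝ → ℝ} {s x : ℝ}

lemma integrableOn_exp_mul_rpow (hs : -1 < s) (hx : 0 < x) :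
    IntegrableOn (fun u => Real.exp (-(x * u)) * u ^ s) (Set.Ioi 0) := by
  simpa [mul_comm] using integrableOn_rpow_mul_exp_neg_mul_rpow hs zero_lt_one hx

lemma laplaceTransform_rpow (hs : -1 < s) (hx : 0 < x) :
    laplaceTransform (fun u => u ^ s) x = Real.Gamma (s + 1) * x ^ (-(s + 1)) := by
  have hgamma := Real.integral_rpow_mul_exp_neg_mul_Ioi (a := s + 1) (by linarith) hx
  rw [add_sub_cancel_right, one_div, Real.inv_rpow hx.le, ← Real.rpow_neg hx.le] at hgamma
  rw [mul_comm, ← hgamma]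
  simp_rw [laplaceTransform, mul_comm]

lemma integrableOn_exp_mul_of_abs_le
    (hK : AEStronglyMeasurable K (volume.restrict (Set.Ioi 0)))
    (hle : ∀ u > 0, |K u| ≤ u ^ s) (hs : -1 < s) (hx : 0 < x) :
    IntegrableOn (fun u => Real.exp (-(x * u)) * K u) (Set.Ioi 0) := by
  refine Integrable.mono' (integrableOn_exp_mul_rpow hs hx)
    ((by fun_prop : Continuous fun u => Real.exp (-(x * u))).aestronglyMeasurable.mul hK) ?_
  filter_upwards [ae_restrict_mem measurableSet_Ioi] with u hu
  rw [norm_mul, Real.norm_of_nonneg (Real.exp_pos _).le, Real.norm_eq_abs]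
  gcongr
  exact hle u hu

lemma abs_laplaceTransform_le
    (hle : ∀ u > 0, |K u| ≤ u ^ s) (hs : -1 < s) (hx : 0 < x) :
    |laplaceTransform K x| ≤ Real.Gamma (s + 1) * x ^ (-(s + 1)) := by
  rw [← laplaceTransform_rpow hs hx, ← Real.norm_eq_abs]
  refine norm_integral_le_of_norm_le (integrableOn_exp_mul_rpow hs hx) ?_
  filter_upwards [ae_restrict_mem measurableSet_Ioi] with u hu
  rw [norm_mul, Real.norm_of_nonneg (Real.exp_pos _).le, Real.norm_eq_abs]
  gcongr
  exact hle u hu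

lemma abs_laplaceTransform_sub_le {C t : ℝ}
    (hK : AEStronglyMeasurable K (volume.restrict (Set.Ioi 0)))
    (hle : ∀ u > 0, |K u| ≤ u ^ s) (hsub : ∀ u > 0, |K u - u ^ s| ≤ C * u ^ t)
    (hs : -1 < s) (ht : -1 < t) (hx : 0 < x) :
    |laplaceTransform K x - Real.Gamma (s + 1) * x ^ (-(s + 1))| ≤
      C * (Real.Gamma (t + 1) * x ^ (-(t + 1))) := by
  rw [← laplaceTransform_rpow hs hx, ← laplaceTransform_rpow ht hx, laplaceTransform,
    laplaceTransform, laplaceTransform,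
    ← integral_sub (integrableOn_exp_mul_of_abs_le hK hle hs hx) (integrableOn_exp_mul_rpow hs hx),
    ← integral_const_mul, ← Real.norm_eq_abs]
  refine norm_integral_le_of_norm_le ((integrableOn_exp_mul_rpow ht hx).const_mul C) ?_
  filter_upwards [ae_restrict_mem measurableSet_Ioi] with u hu
  rw [← mul_sub, norm_mul, Real.norm_of_nonneg (Real.exp_pos _).le, Real.norm_eq_abs,
    mul_left_comm]
  gcongr
  exact hsub u hu

lemma laplaceTransform_second_difference {n m : ℝ}
    (hK : ∀ x ≥ n - m, IntegrableOn (fun u => Real.exp (-(x * u)) * K u) (Set.Ioi 0))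
    (hm : 0 ≤ m) :
    laplaceTransform K (n + m) + laplaceTransform K (n - m) - 2 * laplaceTransform K n =
      ∫ u in Set.Ioi (0 : ℝ),
        Real.exp (-((n - m) * u)) * ((1 - Real.exp (-(m * u))) ^ 2 * K u) := by
  have hadd := hK (n + m) (by linarith)
  have hsub := hK (n - m) le_rfl
  have hmid := hK n (by linarith)
  have hsum : IntegrableOn (fun u => Real.exp (-((n + m) * u)) * K u +
      Real.exp (-((n - m) * u)) * K u) (Set.Ioi 0) := hadd.add hsub
  simp only [laplaceTransform]
  rw [← integral_add hadd hsub, ← integral_const_mul, ← integral_sub hsum (hmid.const_mul 2)]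
  refine integral_congr_ae (ae_of_all _ fun u => ?_)
  have hexp_add : Real.exp (-((n + m) * u)) =
      Real.exp (-((n - m) * u)) * Real.exp (-(m * u)) * Real.exp (-(m * u)) := by
    rw [← Real.exp_add, ← Real.exp_add]; ring_nf
  have hexp_mid : Real.exp (-(n * u)) = Real.exp (-((n - m) * u)) * Real.exp (-(m * u)) := by
    rw [← Real.exp_add]; ring_nf
  simp only [hexp_add, hexp_mid]
  ring

lemma abs_laplaceTransform_second_difference_le {n m : ℝ}
    (hK : AEStronglyMeasurable K (volume.restrict (Set.Ioi 0)))
    (hle : ∀ u > 0, |K u| ≤ u ^ s) (hs : -1 < s) (hm : 0 ≤ m) (hmn : m < n) :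
    |laplaceTransform K (n + m) + laplaceTransform K (n - m) - 2 * laplaceTransform K n| ≤
      m ^ 2 * (Real.Gamma (s + 3) * (n - m) ^ (-(s + 3))) := by
  have hnm : 0 < n - m := sub_pos.2 hmn
  have hs2 : -1 < s + 2 := by linarith
  rw [laplaceTransform_second_difference (fun x hx =>
      integrableOn_exp_mul_of_abs_le hK hle hs (hnm.trans_le hx)) hm,
    show s + 3 = s + 2 + 1 by ring, ← laplaceTransform_rpow hs2 hnm, laplaceTransform,
    ← integral_const_mul, ← Real.norm_eq_abs]
  refine norm_integral_le_of_norm_le ((integrableOn_exp_mul_rpow hs2 hnm).const_mul (m ^ 2)) ?_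
  filter_upwards [ae_restrict_mem measurableSet_Ioi] with u hu
  have hu0 : 0 < u := hu
  have hexp_le : Real.exp (-(m * u)) ≤ 1 := Real.exp_le_one_iff.2 (by nlinarith)
  have hle_mul : 1 - Real.exp (-(m * u)) ≤ m * u := by
    linarith [Real.add_one_le_exp (-(m * u))]
  have hbound : (1 - Real.exp (-(m * u))) ^ 2 * |K u| ≤ (m * u) ^ 2 * u ^ s := by
    gcongr
    exact hle u hu
  calc ‖Real.exp (-((n - m) * u)) * ((1 - Real.exp (-(m * u))) ^ 2 * K u)‖
      = Real.exp (-((n - m) * u)) * ((1 - Real.exp (-(m * u))) ^ 2 * |K u|) := by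
        simp only [Real.norm_eq_abs, abs_mul, Real.abs_exp, abs_pow, sq_abs]
    _ ≤ Real.exp (-((n - m) * u)) * ((m * u) ^ 2 * u ^ s) := by gcongr
    _ = m ^ 2 * (Real.exp (-((n - m) * u)) * u ^ (s + 2)) := by
        rw [Real.rpow_add hu0, Real.rpow_two]; ring

end LaplaceTransform

section DifferencingCoefficients

variable {d : ℝ}

lemma diffCoeff_neg (d : ℝ) (j : ℕ) :
    diffCoeff (-d) j = Real.Gamma (j + d) / (Real.Gamma d * Real.Gamma (j + 1)) := by
  rw [diffCoeff, neg_neg, sub_neg_eq_add]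

lemma diffCoeff_neg_pos (hd : 0 < d) (j : ℕ) : 0 < diffCoeff (-d) j := by
  rw [diffCoeff_neg]
  positivity

lemma gamma_natCast_add_eq_ascPochhammer_mul (hd : 0 < d) (j : ℕ) :
    Real.Gamma (j + d) = (ascPochhammer ℝ j).eval d * Real.Gamma d := by
  induction j with
  | zero => simp
  | succ j ih =>
    rw [Nat.cast_add_one, add_right_comm, Real.Gamma_add_one (by positivity), ih,
      ascPochhammer_succ_eval]
    ring

lemma diffCoeff_neg_eq_choose (hd : 0 < d) (j : ℕ) :
    diffCoeff (-d) j = Ring.choose (d + j - 1) j := by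
  have hchoose : (j.factorial : ℝ) * Ring.choose (d + j - 1) j = (ascPochhammer ℝ j).eval d := by
    rw [← Ring.multichoose_eq, ← nsmul_eq_mul, Ring.factorial_nsmul_multichoose_eq_ascPochhammer,
      Polynomial.ascPochhammer_smeval_eq_eval]
  rw [diffCoeff_neg, gamma_natCast_add_eq_ascPochhammer_mul hd, Real.Gamma_nat_eq_factorial,
    ← hchoose]
  have := (Real.Gamma_pos_of_pos hd).ne'
  field_simp

lemma hasSum_diffCoeff_neg_mul_pow {x : ℝ} (hd : 0 < d) (hx : |x| < 1) :
    HasSum (fun j => diffCoeff (-d) j * x ^ j) ((1 - x) ^ (-d)) := by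
  have hseries := (Real.one_div_one_sub_rpow_hasFPowerSeriesOnBall_zero d).hasSum (y := x)
    (by simpa [enorm_eq_nnnorm] using! hx)
  rw [Real.rpow_neg (by linarith [le_abs_self x]), ← one_div]
  simpa [FormalMultilinearSeries.ofScalars_apply_eq, diffCoeff_neg_eq_choose hd, mul_comm]
    using hseries

end DifferencingCoefficients

section BetaIntegral

variable {α β : ℝ}

lemma integral_rpow_mul_one_sub_rpow (hα : 0 < α) (hβ : 0 < β) :
    ∫ x in Set.Ioo (0 : ℝ) 1, x ^ (α - 1) * (1 - x) ^ (β - 1) = beta α β := by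
  rw [beta_eq_betaIntegralReal α β hα hβ, Complex.betaIntegral,
    intervalIntegral.integral_of_le zero_le_one, integral_Ioc_eq_integral_Ioo]
  refine (Complex.ofReal_re _).symm.trans (congrArg Complex.re ?_)
  rw [← integral_complex_ofReal]
  refine setIntegral_congr_fun measurableSet_Ioo fun x hx => ?_
  simp only [Complex.ofReal_mul, Complex.ofReal_cpow hx.1.le,
    Complex.ofReal_cpow (sub_nonneg.2 hx.2.le)]
  push_cast
  rfl

lemma image_exp_neg_Ioi : (fun u : ℝ => Real.exp (-u)) '' Set.Ioi 0 = Set.Ioo 0 1 := by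
  ext x
  constructor
  · rintro ⟨u, hu, rfl⟩
    exact ⟨Real.exp_pos _, by simpa using hu⟩
  · rintro ⟨hx0, hx1⟩
    exact ⟨-Real.log x, neg_pos.2 (Real.log_neg hx0 hx1), by simp [Real.exp_log hx0]⟩

lemma laplaceTransform_one_sub_exp_rpow (hα : 0 < α) (hβ : 0 < β) :
    laplaceTransform (fun u => (1 - Real.exp (-u)) ^ (β - 1)) α = beta α β := by
  have hsubst := integral_image_eq_integral_abs_deriv_smul (s := Set.Ioi (0 : ℝ))
    (f := fun u => Real.exp (-u)) (f' := fun u => -Real.exp (-u)) measurableSet_Ioi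
    (fun u _ => by simpa using (hasDerivAt_neg u).exp.hasDerivWithinAt)
    (fun x _ y _ hxy => by simpa using hxy) (fun x : ℝ => x ^ (α - 1) * (1 - x) ^ (β - 1))
  rw [image_exp_neg_Ioi, integral_rpow_mul_one_sub_rpow hα hβ] at hsubst
  rw [hsubst]
  refine setIntegral_congr_fun measurableSet_Ioi fun u _ => ?_
  simp only [abs_neg, Real.abs_exp, smul_eq_mul]
  rw [← mul_assoc, ← Real.exp_mul, ← Real.exp_add]
  ring_nf

lemma integrableOn_exp_mul_one_sub_exp_rpow (hα : 0 < α) (hβ : 0 < β) :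
    IntegrableOn (fun u => Real.exp (-(α * u)) * (1 - Real.exp (-u)) ^ (β - 1)) (Set.Ioi 0) := by
  refine .of_integral_ne_zero ?_
  rw [show ∫ u in Set.Ioi (0 : ℝ), Real.exp (-(α * u)) * (1 - Real.exp (-u)) ^ (β - 1) = beta α β
    from laplaceTransform_one_sub_exp_rpow hα hβ]
  exact (beta_pos hα hβ).ne'

lemma diffCoeff_neg_eq_laplaceTransform {d : ℝ} (hd : 0 < d) (hd1 : d < 1) (j : ℕ) :
    diffCoeff (-d) j = (Real.Gamma d * Real.Gamma (1 - d))⁻¹ *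
      laplaceTransform (fun u => (1 - Real.exp (-u)) ^ (-d)) (j + d) := by
  have hbeta := laplaceTransform_one_sub_exp_rpow (α := j + d) (β := 1 - d) (by positivity)
    (by linarith)
  rw [sub_sub_cancel_left] at hbeta
  rw [hbeta, diffCoeff_neg, beta, show (j : ℝ) + d + (1 - d) = j + 1 by ring]
  have hGamma := (Real.Gamma_pos_of_pos hd).ne'
  have hGamma_sub := (Real.Gamma_pos_of_pos (sub_pos.2 hd1)).ne'
  field_simp

end BetaIntegral

section ArfimaKernel

variable {d u x : ℝ}

/-- The function whose Laplace transform at a lag is, up to a constant factor, the autocovariance at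
that lag of the fractionally differenced white noise `(1 - B) ^ (-d) ε`. -/
noncomputable def arfimaKernel (d u : ℝ) : ℝ :=
  (2 * Real.sinh (u / 2)) ^ (-(2 * d))

lemma measurable_arfimaKernel (d : ℝ) : Measurable (arfimaKernel d) := by
  unfold arfimaKernel
  fun_prop

lemma self_le_two_mul_sinh_half (hu : 0 ≤ u) : u ≤ 2 * Real.sinh (u / 2) := by
  linarith [Real.self_le_sinh_iff.2 (div_nonneg hu zero_le_two)]

lemma sinh_le_mul_cosh (hu : 0 ≤ u) : Real.sinh u ≤ u * Real.cosh u := by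
  have hderiv (y : ℝ) :
      HasDerivAt (fun y => y * Real.cosh y - Real.sinh y) (y * Real.sinh y) y := by
    simpa using ((hasDerivAt_id' y).fun_mul (Real.hasDerivAt_cosh y)).fun_sub
      (Real.hasDerivAt_sinh y)
  have hmono : MonotoneOn (fun y => y * Real.cosh y - Real.sinh y) (Set.Ici 0) := by
    refine monotoneOn_of_deriv_nonneg (convex_Ici 0) (by fun_prop) (by fun_prop) fun y hy => ?_
    rw [interior_Ici] at hy
    rw [(hderiv y).deriv]
    exact mul_nonneg hy.le (Real.sinh_nonneg_iff.2 hy.le)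
  have h := hmono Set.self_mem_Ici hu hu
  simp only [Real.sinh_zero, zero_mul, sub_zero] at h
  linarith

lemma two_mul_sinh_half_le (hu : 0 ≤ u) : 2 * Real.sinh (u / 2) ≤ u * Real.exp (u ^ 2 / 8) := by
  have hu2 : 0 ≤ u / 2 := by positivity
  calc 2 * Real.sinh (u / 2)
      ≤ 2 * (u / 2 * Real.cosh (u / 2)) := by gcongr; exact sinh_le_mul_cosh hu2
    _ ≤ 2 * (u / 2 * Real.exp ((u / 2) ^ 2 / 2)) := by gcongr; exact Real.cosh_le_exp_half_sq _
    _ = u * Real.exp (u ^ 2 / 8) := by ring_nf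

lemma arfimaKernel_pos (d : ℝ) (hu : 0 < u) : 0 < arfimaKernel d u :=
  Real.rpow_pos_of_pos (hu.trans_le (self_le_two_mul_sinh_half hu.le)) _

lemma arfimaKernel_le (hd : 0 ≤ d) (hu : 0 < u) : arfimaKernel d u ≤ u ^ (-(2 * d)) :=
  Real.rpow_le_rpow_of_nonpos hu (self_le_two_mul_sinh_half hu.le) (by linarith)

lemma abs_arfimaKernel_le (hd : 0 ≤ d) (hu : 0 < u) : |arfimaKernel d u| ≤ u ^ (-(2 * d)) := by
  rw [abs_of_pos (arfimaKernel_pos d hu)]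
  exact arfimaKernel_le hd hu

lemma abs_arfimaKernel_sub_le (hd : 0 ≤ d) (hu : 0 < u) :
    |arfimaKernel d u - u ^ (-(2 * d))| ≤ d / 4 * u ^ (2 - 2 * d) := by
  rw [abs_sub_comm, abs_of_nonneg (sub_nonneg.2 (arfimaKernel_le hd hu)), sub_le_comm]
  calc u ^ (-(2 * d)) - d / 4 * u ^ (2 - 2 * d)
      = u ^ (-(2 * d)) * (u ^ 2 / 8 * -(2 * d) + 1) := by
        rw [sub_eq_add_neg 2, Real.rpow_add hu, Real.rpow_two]
        ring
    _ ≤ u ^ (-(2 * d)) * Real.exp (u ^ 2 / 8 * -(2 * d)) := by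
        gcongr
        exact Real.add_one_le_exp _
    _ = (u * Real.exp (u ^ 2 / 8)) ^ (-(2 * d)) := by
        rw [Real.mul_rpow hu.le (Real.exp_pos _).le, ← Real.exp_mul]
    _ ≤ arfimaKernel d u :=
        Real.rpow_le_rpow_of_nonpos (hu.trans_le (self_le_two_mul_sinh_half hu.le))
          (two_mul_sinh_half_le hu.le) (by linarith)

lemma arfimaKernel_eq (d : ℝ) (hu : 0 < u) :
    arfimaKernel d u = Real.exp (-(d * u)) * (1 - Real.exp (-u)) ^ (-(2 * d)) := by
  have hpos : 0 ≤ 1 - Real.exp (-u) := by simpa using hu.le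
  have hsinh : 2 * Real.sinh (u / 2) = Real.exp (u / 2) * (1 - Real.exp (-u)) := by
    rw [Real.sinh_eq, mul_sub, ← Real.exp_add]
    ring_nf
  rw [arfimaKernel, hsinh, Real.mul_rpow (Real.exp_pos _).le hpos, ← Real.exp_mul]
  ring_nf

lemma integrableOn_exp_mul_arfimaKernel (hx : 0 < x + d) (hd : d < 1 / 2) :
    IntegrableOn (fun u => Real.exp (-(x * u)) * arfimaKernel d u) (Set.Ioi 0) := by
  refine (integrableOn_exp_mul_one_sub_exp_rpow hx
    (show 0 < 1 - 2 * d by linarith)).congr_fun (fun u hu => ?_) measurableSet_Ioi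
  simp only [arfimaKernel_eq d hu, sub_sub_cancel_left]
  rw [← mul_assoc, ← Real.exp_add]
  ring_nf

end ArfimaKernel

section ArfimaACVF

variable {d x : ℝ}

/-- The autocovariance function of the fractionally differenced white noise `(1 - B) ^ (-d) ε`,
extended to real lags as a Laplace transform. -/
noncomputable def arfimaACVF (d x : ℝ) : ℝ :=
  (Real.Gamma d * Real.Gamma (1 - d))⁻¹ * laplaceTransform (arfimaKernel d) x

/-- The constant `c` in `arfimaACVF d x ~ c * x ^ (2 * d - 1)` as `x → ∞`. -/
noncomputable def arfimaConst (d : ℝ) : ℝ :=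
  (Real.Gamma d * Real.Gamma (1 - d))⁻¹ * Real.Gamma (1 - 2 * d)

lemma hasSum_integral_of_nonneg {α ι : Type*} [MeasurableSpace α] [Countable ι] {μ : Measure α}
    {F : ι → α → ℝ} {f : α → ℝ} (hF : ∀ i, AEStronglyMeasurable (F i) μ)
    (hF_nonneg : ∀ i, 0 ≤ᵐ[μ] F i) (hf : Integrable f μ)
    (hsum : ∀ᵐ a ∂μ, HasSum (fun i => F i a) (f a)) :
    HasSum (fun i => ∫ a, F i a ∂μ) (∫ a, f a ∂μ) :=
  hasSum_integral_of_dominated_convergence F hF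
    (fun i => (hF_nonneg i).mono fun _ ha => (Real.norm_of_nonneg ha).le)
    (hsum.mono fun _ ha => ha.summable)
    (hf.congr (hsum.mono fun _ ha => ha.tsum_eq.symm)) hsum

lemma hasSum_diffCoeff_mul_exp_mul (hd : 0 < d) (k : ℕ) {u : ℝ} (hu : 0 < u) :
    HasSum (fun i : ℕ => diffCoeff (-d) i *
        (Real.exp (-(((i + k : ℕ) + d) * u)) * (1 - Real.exp (-u)) ^ (-d)))
      (Real.exp (-(k * u)) * arfimaKernel d u) := by
  have hpos : 0 < 1 - Real.exp (-u) := by simpa using hu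
  have hlt : |Real.exp (-u)| < 1 := by simpa using hu
  convert! (hasSum_diffCoeff_neg_mul_pow hd hlt).mul_left
    (Real.exp (-(k * u)) * (Real.exp (-(d * u)) * (1 - Real.exp (-u)) ^ (-d))) using 1
  · ext i
    rw [show -(((i + k : ℕ) + d) * u) = -(k * u) + -(d * u) + i * -u by push_cast; ring,
      Real.exp_add, Real.exp_add, Real.exp_nat_mul]
    ring
  · rw [arfimaKernel_eq d hu, mul_assoc, mul_assoc, ← Real.rpow_add hpos, two_mul, neg_add]

lemma hasSum_diffCoeff_mul_diffCoeff (hd : 0 < d) (hd1 : d < 1 / 2) (k : ℕ) :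
    HasSum (fun i : ℕ => diffCoeff (-d) i * diffCoeff (-d) (i + k)) (arfimaACVF d k) := by
  have hmem : ∀ᵐ u : ℝ ∂volume.restrict (Set.Ioi 0), u ∈ Set.Ioi (0 : ℝ) :=
    ae_restrict_mem measurableSet_Ioi
  have hint := hasSum_integral_of_nonneg
    (fun i : ℕ => (by fun_prop : Measurable fun u => diffCoeff (-d) i *
      (Real.exp (-(((i + k : ℕ) + d) * u)) *
        (1 - Real.exp (-u)) ^ (-d))).aestronglyMeasurable)
    (fun i => hmem.mono fun u hu => ?_)
    (integrableOn_exp_mul_arfimaKernel (x := k) (by positivity) hd1)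
    (hmem.mono fun u hu => hasSum_diffCoeff_mul_exp_mul hd k hu)
  · convert! hint.mul_left (Real.Gamma d * Real.Gamma (1 - d))⁻¹ using 1
    ext i
    rw [integral_const_mul, diffCoeff_neg_eq_laplaceTransform hd (by linarith) (i + k),
      laplaceTransform]
    ring
  · have hpos : 0 ≤ 1 - Real.exp (-u) := by simpa using (le_of_lt hu)
    have hcoeff := (diffCoeff_neg_pos hd i).le
    simp only [Pi.zero_apply]
    positivity

lemma inv_gamma_mul_gamma_pos (hd : 0 < d) (hd1 : d < 1) :
    0 < (Real.Gamma d * Real.Gamma (1 - d))⁻¹ := by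
  have hGamma_sub := Real.Gamma_pos_of_pos (sub_pos.2 hd1)
  exact inv_pos.2 (mul_pos (Real.Gamma_pos_of_pos hd) hGamma_sub)

lemma exists_abs_arfimaACVF_sub_le (hd : 0 < d) (hd1 : d < 1 / 2) :
    ∃ E, ∀ x > 0, |arfimaACVF d x - arfimaConst d * x ^ (2 * d - 1)| ≤ E * x ^ (2 * d - 3) := by
  have hpos := inv_gamma_mul_gamma_pos hd (by linarith)
  refine ⟨(Real.Gamma d * Real.Gamma (1 - d))⁻¹ * (d / 4 * Real.Gamma (3 - 2 * d)),
    fun x hx => ?_⟩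
  have h := abs_laplaceTransform_sub_le (measurable_arfimaKernel d).aestronglyMeasurable
    (fun u hu => abs_arfimaKernel_le hd.le hu) (fun u hu => abs_arfimaKernel_sub_le hd.le hu)
    (by linarith) (by linarith) hx
  rw [show -(2 * d) + 1 = 1 - 2 * d by ring, show 2 - 2 * d + 1 = 3 - 2 * d by ring, neg_sub,
    neg_sub, ← mul_assoc (d / 4)] at h
  rw [arfimaACVF, arfimaConst, mul_assoc, ← mul_sub, abs_mul, abs_of_pos hpos, mul_assoc]
  gcongr

lemma abs_arfimaACVF_le (hd : 0 < d) (hd1 : d < 1 / 2) (hx : 0 < x) :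
    |arfimaACVF d x| ≤ arfimaConst d * x ^ (2 * d - 1) := by
  have hpos := inv_gamma_mul_gamma_pos hd (by linarith)
  have h := abs_laplaceTransform_le (fun u hu => abs_arfimaKernel_le hd.le hu) (by linarith) hx
  rw [show -(2 * d) + 1 = 1 - 2 * d by ring, neg_sub] at h
  rw [arfimaACVF, arfimaConst, abs_mul, abs_of_pos hpos, mul_assoc]
  gcongr

lemma exists_abs_arfimaACVF_second_difference_le (hd : 0 < d) (hd1 : d < 1 / 2) :
    ∃ E, ∀ n m : ℝ, 0 ≤ m → m < n →
      |arfimaACVF d (n + m) + arfimaACVF d (n - m) - 2 * arfimaACVF d n| ≤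
        E * m ^ 2 * (n - m) ^ (2 * d - 3) := by
  have hpos := inv_gamma_mul_gamma_pos hd (by linarith)
  refine ⟨(Real.Gamma d * Real.Gamma (1 - d))⁻¹ * Real.Gamma (3 - 2 * d), fun n m hm hmn => ?_⟩
  have h := abs_laplaceTransform_second_difference_le
    (measurable_arfimaKernel d).aestronglyMeasurable
    (fun u hu => abs_arfimaKernel_le hd.le hu) (by linarith) hm hmn
  rw [show -(2 * d) + 3 = 3 - 2 * d by ring, neg_sub] at h
  simp only [arfimaACVF]
  rw [mul_left_comm, ← mul_add, ← mul_sub, abs_mul, abs_of_pos hpos]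
  refine (mul_le_mul_of_nonneg_left h hpos.le).trans_eq ?_
  ring

end ArfimaACVF

section MeanSquareLimits

variable {Ω ι : Type*} [MeasurableSpace Ω] {P : Measure Ω} {l : Filter ι}
  {U V : ι → Ω → ℝ} {u v : Ω → ℝ}

lemma inner_toLp_eq_integral_mul (hu : MemLp u 2 P) (hv : MemLp v 2 P) :
    inner ℝ (hu.toLp u) (hv.toLp v) = ∫ ω, u ω * v ω ∂P := by
  rw [L2.inner_def]
  refine integral_congr_ae ?_
  filter_upwards [hu.coeFn_toLp, hv.coeFn_toLp] with ω hω_u hω_v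
  rw [hω_u, hω_v, real_inner_eq_re_inner]
  simp [mul_comm]

lemma tendsto_integral_mul_of_tendsto_eLpNorm
    (hU : ∀ n, MemLp (U n) 2 P) (hV : ∀ n, MemLp (V n) 2 P) (hu : MemLp u 2 P) (hv : MemLp v 2 P)
    (hUu : Tendsto (fun n => eLpNorm (U n - u) 2 P) l (𝓝 0))
    (hVv : Tendsto (fun n => eLpNorm (V n - v) 2 P) l (𝓝 0)) :
    Tendsto (fun n => ∫ ω, U n ω * V n ω ∂P) l (𝓝 (∫ ω, u ω * v ω ∂P)) := by
  have hU_lim := (Lp.tendsto_Lp_iff_tendsto_eLpNorm'' U hU u hu).2 hUu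
  have hV_lim := (Lp.tendsto_Lp_iff_tendsto_eLpNorm'' V hV v hv).2 hVv
  simpa only [inner_toLp_eq_integral_mul] using hU_lim.inner (𝕜 := ℝ) hV_lim

lemma tendsto_integral_of_tendsto_eLpNorm [IsFiniteMeasure P]
    (hU : ∀ n, MemLp (U n) 2 P) (hu : MemLp u 2 P)
    (hUu : Tendsto (fun n => eLpNorm (U n - u) 2 P) l (𝓝 0)) :
    Tendsto (fun n => ∫ ω, U n ω ∂P) l (𝓝 (∫ ω, u ω ∂P)) := by
  have hone : MemLp (fun _ : Ω => (1 : ℝ)) 2 P := memLp_const 1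
  simpa using tendsto_integral_mul_of_tendsto_eLpNorm (V := fun _ _ => (1 : ℝ)) (v := fun _ => 1)
    hU (fun _ => hone) hu hone hUu (by simpa using tendsto_const_nhds)

lemma tendsto_covariance_of_tendsto_eLpNorm [IsProbabilityMeasure P]
    (hU : ∀ n, MemLp (U n) 2 P) (hV : ∀ n, MemLp (V n) 2 P) (hu : MemLp u 2 P) (hv : MemLp v 2 P)
    (hUu : Tendsto (fun n => eLpNorm (U n - u) 2 P) l (𝓝 0))
    (hVv : Tendsto (fun n => eLpNorm (V n - v) 2 P) l (𝓝 0)) :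
    Tendsto (fun n => covariance (U n) (V n) P) l (𝓝 (covariance u v P)) := by
  simp only [fun n => covariance_eq_sub (hU n) (hV n), covariance_eq_sub hu hv]
  exact (tendsto_integral_mul_of_tendsto_eLpNorm hU hV hu hv hUu hVv).sub
    ((tendsto_integral_of_tendsto_eLpNorm hU hu hUu).mul
      (tendsto_integral_of_tendsto_eLpNorm hV hv hVv))

end MeanSquareLimits

section LaggedSums

lemma summable_abs_mul_add {a : ℤ → ℝ} {g : ℝ} (hg : HasSum (fun i => a i * a i) g) (l : ℤ) :
    Summable (fun i => |a i * a (i + l)|) ∧ ∑' i, |a i * a (i + l)| ≤ g := by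
  have hshift : HasSum (fun i => a (i + l) * a (i + l)) g :=
    (Equiv.addRight l).hasSum_iff (f := fun i => a i * a i) |>.2 hg
  have hmean : HasSum (fun i => (a i * a i + a (i + l) * a (i + l)) / 2) g := by
    simpa using (hg.add hshift).div_const 2
  have hle (i : ℤ) : |a i * a (i + l)| ≤ (a i * a i + a (i + l) * a (i + l)) / 2 := by
    rw [abs_mul]
    nlinarith [sq_nonneg (|a i| - |a (i + l)|), sq_abs (a i), sq_abs (a (i + l))]
  have hsum := hmean.summable.of_nonneg_of_le (fun i => abs_nonneg _) hle
  exact ⟨hsum, hasSum_le hle hsum.hasSum hmean⟩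

lemma hasSum_mul_mul_add_sub {a G γ : ℤ → ℝ} (hG : ∀ l, HasSum (fun i => a i * a (i + l)) (G l))
    (hγ : Summable fun m => |γ m|) (k : ℤ) :
    HasSum (fun p : ℤ × ℤ => γ p.1 * (a p.2 * a (p.2 + (k - p.1)))) (∑' m, γ m * G (k - m)) := by
  have hG0 : HasSum (fun i => a i * a i) (G 0) := by simpa using hG 0
  have hsum : Summable fun p : ℤ × ℤ => γ p.1 * (a p.2 * a (p.2 + (k - p.1))) := by
    refine Summable.of_norm ((summable_prod_of_nonneg fun p => norm_nonneg _).2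
      ⟨fun m => ?_, (hγ.mul_right (G 0)).of_nonneg_of_le
        (fun m => tsum_nonneg fun i => norm_nonneg _) fun m => ?_⟩)
    · simpa only [Real.norm_eq_abs, abs_mul (γ m)] using
        (summable_abs_mul_add hG0 (k - m)).1.mul_left |γ m|
    · simp only [Real.norm_eq_abs, abs_mul (γ m), tsum_mul_left]
      gcongr
      exact (summable_abs_mul_add hG0 (k - m)).2
  have hfiber := hsum.hasSum.prod_fiberwise fun m => (hG (k - m)).mul_left (γ m)
  rw [hfiber.tsum_eq]
  exact hsum.hasSum

/-- The substitution `m = k + i - j` in the double sum over pairs `(m, i)`. -/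
def lagEquiv (k : ℤ) : ℤ × ℤ ≃ ℤ × ℤ where
  toFun p := (k + p.1 - p.2, p.1)
  invFun p := (p.2, k + p.2 - p.1)
  left_inv p := by ext <;> simp
  right_inv p := by ext <;> simp

lemma hasSum_mul_mul_lag {a G γ : ℤ → ℝ} (hG : ∀ l, HasSum (fun i => a i * a (i + l)) (G l))
    (hγ : Summable fun m => |γ m|) (k : ℤ) :
    HasSum (fun p : ℤ × ℤ => a p.1 * a p.2 * γ (k + p.1 - p.2)) (∑' m, γ m * G (k - m)) := by
  refine ((lagEquiv k).hasSum_iff.2 (hasSum_mul_mul_add_sub hG hγ k)).congr_fun fun p => ?_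
  simp only [lagEquiv, Function.comp_apply, Equiv.coe_fn_mk,
    show p.1 + (k - (k + p.1 - p.2)) = p.2 by ring]
  ring

lemma hasSum_extend_natCast_mul_add {a G : ℕ → ℝ}
    (hG : ∀ k : ℕ, HasSum (fun i : ℕ => a i * a (i + k)) (G k)) (l : ℤ) :
    HasSum (fun i : ℤ => Function.extend ((↑) : ℕ → ℤ) a 0 i *
      Function.extend ((↑) : ℕ → ℤ) a 0 (i + l)) (G l.natAbs) := by
  have hnat (k : ℕ) : HasSum (fun i : ℤ => Function.extend ((↑) : ℕ → ℤ) a 0 i *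
      Function.extend ((↑) : ℕ → ℤ) a 0 (i + k)) (G k) := by
    refine (Nat.cast_injective.hasSum_iff fun i hi => ?_).1 ((hG k).congr_fun ?_)
    · rw [Function.extend_apply' _ _ _ hi, Pi.zero_apply, zero_mul]
    · intro i
      simp only [Function.comp_apply, ← Nat.cast_add, Nat.cast_injective.extend_apply]
  obtain ⟨k, rfl | rfl⟩ := l.eq_nat_or_neg
  · simpa using hnat k
  · rw [← (Equiv.addRight (k : ℤ)).hasSum_iff]
    simpa [Function.comp_def, mul_comm] using hnat k

lemma hasSum_mul_mul_natCast_lag {a G : ℕ → ℝ} {γ : ℤ → ℝ}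
    (hG : ∀ k : ℕ, HasSum (fun i : ℕ => a i * a (i + k)) (G k))
    (hγ : Summable fun m => |γ m|) (k : ℤ) :
    HasSum (fun p : ℕ × ℕ => a p.1 * a p.2 * γ (k + p.1 - p.2))
      (∑' m, γ m * G (k - m).natAbs) := by
  have hinj : Function.Injective (Prod.map ((↑) : ℕ → ℤ) ((↑) : ℕ → ℤ)) :=
    Nat.cast_injective.prodMap Nat.cast_injective
  refine ((hinj.hasSum_iff ?_).2
    (hasSum_mul_mul_lag (hasSum_extend_natCast_mul_add hG) hγ k)).congr_fun fun p => ?_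
  · rintro ⟨i, j⟩ hij
    by_cases hi : i ∈ Set.range ((↑) : ℕ → ℤ)
    · have hj : j ∉ Set.range ((↑) : ℕ → ℤ) := fun hj => hij (Set.range_prodMap ▸ ⟨hi, hj⟩)
      simp [Function.extend_apply' _ _ _ hj]
    · simp [Function.extend_apply' _ _ _ hi]
  · simp [Nat.cast_injective.extend_apply]

lemma tendsto_sum_range_sum_range {f : ℕ × ℕ → ℝ} {s : ℝ} (hf : HasSum f s) :
    Tendsto (fun N : ℕ => ∑ i ∈ Finset.range N, ∑ j ∈ Finset.range N, f (i, j)) atTop (𝓝 s) := by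
  simpa [Function.comp_def, Finset.sum_product] using
    hf.comp (tendsto_finsetProd_atTop.comp
      (tendsto_finset_range.prodMk tendsto_finset_range |>.mono_right prod_atTop_atTop_eq.le))

end LaggedSums

section FractionalDifference

variable {Ω : Type*} [MeasurableSpace Ω] {P : Measure Ω} {X Y : ℤ → Ω → ℝ} {d : ℝ}

namespace SecondOrderStationary

lemma covariance_eq_acvf (hY : SecondOrderStationary Y P) (s t : ℤ) :
    covariance (Y s) (Y t) P = acvf Y P (t - s) := by
  simpa [acvf] using hY.cov_eq s 0 (t - s)

lemma memLp_sum_diffCoeff (hY : SecondOrderStationary Y P) (d : ℝ) (t : ℤ) (N : ℕ) :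
    MemLp (fun ω => ∑ j ∈ Finset.range N, diffCoeff d j * Y (t - j) ω) 2 P :=
  memLp_finsetSum _ fun _ _ => (hY.memLp _).const_mul _

end SecondOrderStationary

namespace IsFractionalDifference

lemma tendsto_eLpNorm (hX : IsFractionalDifference d Y X P) (t : ℤ) :
    Tendsto (fun N : ℕ => eLpNorm
      ((fun ω => ∑ j ∈ Finset.range N, diffCoeff d j * Y (t - j) ω) - X t) 2 P) atTop (𝓝 0) := by
  simp_rw [eLpNorm_sub_comm _ (X t)]
  exact (hX t).2

variable [IsProbabilityMeasure P]

lemma tendsto_integral (hX : IsFractionalDifference d Y X P) (hY : SecondOrderStationary Y P)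
    (t : ℤ) :
    Tendsto (fun N : ℕ => ∑ j ∈ Finset.range N, diffCoeff d j * ∫ ω, Y 0 ω ∂P) atTop
      (𝓝 (∫ ω, X t ω ∂P)) := by
  refine (tendsto_integral_of_tendsto_eLpNorm (hY.memLp_sum_diffCoeff d t) (hX t).1
    (hX.tendsto_eLpNorm t)).congr fun N => ?_
  rw [integral_finsetSum _ fun j _ => ((hY.memLp _).const_mul _).integrable one_le_two]
  refine Finset.sum_congr rfl fun j _ => ?_
  rw [integral_const_mul, hY.mean_eq _ 0]

lemma tendsto_covariance (hX : IsFractionalDifference d Y X P) (hY : SecondOrderStationary Y P)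
    (t k : ℤ) :
    Tendsto (fun N : ℕ => ∑ i ∈ Finset.range N, ∑ j ∈ Finset.range N,
      diffCoeff d i * diffCoeff d j * acvf Y P (k + i - j)) atTop
      (𝓝 (covariance (X t) (X (t + k)) P)) := by
  refine (tendsto_covariance_of_tendsto_eLpNorm (hY.memLp_sum_diffCoeff d t)
    (hY.memLp_sum_diffCoeff d (t + k)) (hX t).1 (hX (t + k)).1 (hX.tendsto_eLpNorm t)
    (hX.tendsto_eLpNorm (t + k))).congr fun N => ?_
  rw [covariance_fun_sum_fun_sum' (fun i _ => (hY.memLp _).const_mul _)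
    (fun j _ => (hY.memLp _).const_mul _)]
  refine Finset.sum_congr rfl fun i _ => Finset.sum_congr rfl fun j _ => ?_
  rw [covariance_const_mul_left, covariance_const_mul_right, hY.covariance_eq_acvf,
    show t + k - j - (t - i) = k + i - j by ring, mul_assoc]

lemma secondOrderStationary (hX : IsFractionalDifference d Y X P)
    (hY : SecondOrderStationary Y P) : SecondOrderStationary X P where
  memLp t := (hX t).1
  mean_eq s t := tendsto_nhds_unique (hX.tendsto_integral hY s) (hX.tendsto_integral hY t)
  cov_eq s t k :=
    tendsto_nhds_unique (hX.tendsto_covariance hY s k) (hX.tendsto_covariance hY t k)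

lemma acvf_eq_tsum (hX : IsFractionalDifference (-d) Y X P) (hY : SecondOrderStationary Y P)
    (hd : 0 < d) (hd1 : d < 1 / 2) (hγ : Summable fun m => |acvf Y P m|) (k : ℤ) :
    acvf X P k = ∑' m, acvf Y P m * arfimaACVF d |((k - m : ℤ) : ℝ)| := by
  have hlim := hX.tendsto_covariance hY 0 k
  have hsum := tendsto_sum_range_sum_range (hasSum_mul_mul_natCast_lag (a := diffCoeff (-d))
    (G := fun n : ℕ => arfimaACVF d n) (hasSum_diffCoeff_mul_diffCoeff hd hd1) hγ k)
  rw [zero_add] at hlim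
  simp_rw [Nat.cast_natAbs, Int.cast_abs] at hsum
  exact tendsto_nhds_unique hlim hsum

end IsFractionalDifference

end FractionalDifference

section PowerDecay

variable {p : ℝ}

lemma sum_range_rpow_sub_one_le (hp : 0 < p) (hp1 : p ≤ 1) (n : ℕ) :
    ∑ l ∈ Finset.range n, ((l : ℝ) + 1) ^ (p - 1) ≤ (n : ℝ) ^ p / p := by
  induction n with
  | zero => simp [Real.zero_rpow hp.ne']
  | succ n ih =>
    have hn : (0 : ℝ) < n + 1 := by positivity
    have hinv : -1 ≤ -1 / ((n : ℝ) + 1) := by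
      rw [le_div_iff₀ hn]
      linarith [n.cast_nonneg (α := ℝ)]
    have bernoulli : (n : ℝ) ^ p ≤ (n + 1 : ℝ) ^ p - p * (n + 1 : ℝ) ^ (p - 1) := by
      calc (n : ℝ) ^ p = ((n + 1) * (1 + -1 / (n + 1 : ℝ))) ^ p := by congr 1; field_simp; ring
        _ = (n + 1 : ℝ) ^ p * (1 + -1 / (n + 1 : ℝ)) ^ p :=
            Real.mul_rpow hn.le (by linarith)
        _ ≤ (n + 1 : ℝ) ^ p * (1 + p * (-1 / (n + 1 : ℝ))) := by
            gcongr
            exact rpow_one_add_le_one_add_mul_self hinv hp.le hp1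
        _ = _ := by rw [Real.rpow_sub_one hn.ne']; ring
    rw [Finset.sum_range_succ, Nat.cast_succ]
    rw [le_div_iff₀ hp] at ih ⊢
    linarith

lemma sum_Ioo_one_add_abs_rpow_le (hp : 0 < p) (hp1 : p ≤ 1) (n : ℕ) :
    ∑ l ∈ Finset.Ioo (-n : ℤ) n, (1 + |(l : ℝ)|) ^ (p - 1) ≤ 2 / p * (n : ℝ) ^ p := by
  rcases n with _ | n
  · simp [Real.zero_rpow hp.ne']
  have hIoo : Finset.Ioo (-(n + 1 : ℕ) : ℤ) (n + 1 : ℕ) = Finset.Icc (-n : ℤ) n := by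
    ext l
    simp only [Finset.mem_Ioo, Finset.mem_Icc]
    omega
  have hsum := sum_range_rpow_sub_one_le hp hp1 (n + 1)
  have heven : Function.Even fun l : ℤ => (1 + |(l : ℝ)|) ^ (p - 1) := fun l => by simp
  rw [hIoo, Finset.sum_Icc_of_even_eq_range heven]
  simp only [Int.cast_natCast, Nat.abs_cast, Int.cast_zero, abs_zero,
    two_nsmul, add_comm (1 : ℝ)]
  calc _ ≤ ((n + 1 : ℕ) : ℝ) ^ p / p + ((n + 1 : ℕ) : ℝ) ^ p / p - 1 := by gcongr; simp
    _ ≤ ((n + 1 : ℕ) : ℝ) ^ p / p + ((n + 1 : ℕ) : ℝ) ^ p / p := sub_le_self _ zero_le_one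
    _ = 2 / p * ((n + 1 : ℕ) : ℝ) ^ p := by ring

/-- The even weight `(1 + |l|) ^ (p - 1)` on the integers, restricted to `|l| < n`. It majorises
a kernel decaying like `|l| ^ (p - 1)` on the lags where the decay itself gains nothing. -/
noncomputable def truncatedWeight (p : ℝ) (n : ℕ) : ℤ → ℝ :=
  (Finset.Ioo (-n : ℤ) n : Set ℤ).indicator fun l => (1 + |(l : ℝ)|) ^ (p - 1)

lemma truncatedWeight_nonneg (p : ℝ) (n : ℕ) (l : ℤ) : 0 ≤ truncatedWeight p n l :=
  Set.indicator_nonneg (fun l _ => by positivity) l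

lemma hasSum_truncatedWeight_add (p : ℝ) (n : ℕ) (k : ℤ) :
    HasSum (fun m => truncatedWeight p n (k + m))
      (∑ l ∈ Finset.Ioo (-n : ℤ) n, (1 + |(l : ℝ)|) ^ (p - 1)) :=
  (Equiv.addLeft k).hasSum_iff.2 (hasSum_subtype_iff_indicator.1 (Finset.hasSum _ _))

lemma hasSum_truncatedWeight_sub (p : ℝ) (n : ℕ) (k : ℤ) :
    HasSum (fun m => truncatedWeight p n (k - m))
      (∑ l ∈ Finset.Ioo (-n : ℤ) n, (1 + |(l : ℝ)|) ^ (p - 1)) :=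
  (Equiv.subLeft k).hasSum_iff.2 (hasSum_subtype_iff_indicator.1 (Finset.hasSum _ _))

end PowerDecay

section Convolution

variable {G γ : ℤ → ℝ} {A C E p : ℝ}

lemma summable_mul_of_abs_le (hγ : Summable fun m => |γ m|) (hG : ∀ l, |G l| ≤ A) :
    Summable fun m => γ m * G m :=
  Summable.of_norm_bounded (hγ.mul_right A) fun m => by
    rw [norm_mul, Real.norm_eq_abs, Real.norm_eq_abs]
    exact mul_le_mul_of_nonneg_left (hG m) (abs_nonneg _)

lemma tsum_mul_sub_sub_tsum_mul (heven : Function.Even γ) (hγ : Summable fun m => |γ m|)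
    (hG : ∀ l, |G l| ≤ A) (n : ℤ) :
    ∑' m, γ m * G (n - m) - (∑' m, γ m) * G n =
      ∑' m, γ m * ((G (n + m) + G (n - m) - 2 * G n) / 2) := by
  have hreflect : ∑' m, γ m * G (n + m) = ∑' m, γ m * G (n - m) := by
    rw [← (Equiv.neg ℤ).tsum_eq]
    simp only [Equiv.neg_apply, heven _, ← sub_eq_add_neg]
  have hadd : Summable fun m => γ m * G (n + m) :=
    summable_mul_of_abs_le (G := fun m => G (n + m)) hγ fun _ => hG _
  have hsub : Summable fun m => γ m * G (n - m) :=
    summable_mul_of_abs_le (G := fun m => G (n - m)) hγ fun _ => hG _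
  calc _ = (∑' m, γ m * G (n + m) + ∑' m, γ m * G (n - m)) / 2 - (∑' m, γ m) * G n := by
        rw [hreflect]; ring
    _ = ∑' m, ((γ m * G (n + m) + γ m * G (n - m)) / 2 - γ m * G n) := by
        rw [Summable.tsum_sub ((hadd.add hsub).div_const 2) (hγ.of_abs.mul_right _),
          tsum_div_const, Summable.tsum_add hadd hsub, tsum_mul_right]
    _ = _ := tsum_congr fun m => by ring

lemma abs_mul_rpow_le_of_lt_two_mul (hp1 : p ≤ 1) (hC : ∀ m : ℤ, |(m : ℝ)| ^ 3 * |γ m| ≤ C)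
    {n : ℕ} (hn : 1 ≤ n) {m : ℤ} (hm : (n : ℝ) < 2 * |(m : ℝ)|) (l : ℤ) :
    |γ m| * (1 + |(l : ℝ)|) ^ (p - 1) ≤
      4 * (|(m : ℝ)| ^ 2 * |γ m|) * (n : ℝ) ^ (p - 3) +
        8 * C / (n : ℝ) ^ 3 * truncatedWeight p n l := by
  have hn0 : (0 : ℝ) < n := by exact_mod_cast hn
  by_cases hl : l ∈ (Finset.Ioo (-n : ℤ) n : Set ℤ)
  · have hγm : |γ m| ≤ 8 * C / (n : ℝ) ^ 3 := by
      rw [le_div_iff₀ (by positivity)]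
      calc |γ m| * (n : ℝ) ^ 3 ≤ |γ m| * (2 * |(m : ℝ)|) ^ 3 := by gcongr
        _ = 8 * (|(m : ℝ)| ^ 3 * |γ m|) := by ring
        _ ≤ 8 * C := by gcongr; exact hC m
    rw [truncatedWeight, Set.indicator_of_mem hl]
    refine (mul_le_mul_of_nonneg_right hγm (by positivity)).trans ?_
    exact le_add_of_nonneg_left (by positivity)
  · have hnl : (n : ℝ) ≤ |(l : ℝ)| := by
      rw [Finset.mem_coe, Finset.mem_Ioo, ← abs_lt, not_lt] at hl
      exact_mod_cast hl
    have hw : (1 + |(l : ℝ)|) ^ (p - 1) ≤ (n : ℝ) ^ (p - 1) :=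
      Real.rpow_le_rpow_of_nonpos hn0 (by linarith) (by linarith)
    rw [truncatedWeight, Set.indicator_of_notMem hl, mul_zero, add_zero,
      show p - 3 = p - 1 - (2 : ℕ) by push_cast; ring, Real.rpow_sub_natCast hn0.ne',
      ← mul_div_assoc, le_div_iff₀ (by positivity)]
    calc |γ m| * (1 + |(l : ℝ)|) ^ (p - 1) * (n : ℝ) ^ 2
        ≤ |γ m| * (n : ℝ) ^ (p - 1) * (2 * |(m : ℝ)|) ^ 2 := by gcongr
      _ = _ := by ring

lemma abs_mul_second_difference_le_of_lt_two_mul (hp1 : p ≤ 1)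
    (hC : ∀ m : ℤ, |(m : ℝ)| ^ 3 * |γ m| ≤ C)
    (hG : ∀ l, |G l| ≤ A * (1 + |(l : ℝ)|) ^ (p - 1))
    {n : ℕ} (hn : 1 ≤ n) {m : ℤ} (hm : (n : ℝ) < 2 * |(m : ℝ)|) :
    |γ m| * (|G (n + m) + G (n - m) - 2 * G n| / 2) ≤
      8 * A * (n : ℝ) ^ (p - 3) * (|(m : ℝ)| ^ 2 * |γ m|) +
        4 * A * C / (n : ℝ) ^ 3 * (truncatedWeight p n (n + m) + truncatedWeight p n (n - m)) := by
  have hA : 0 ≤ A := by simpa using (abs_nonneg _).trans (hG 0)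
  have hfar : ∀ l, |γ m| * |G l| ≤ A * (4 * (|(m : ℝ)| ^ 2 * |γ m|) * (n : ℝ) ^ (p - 3) +
      8 * C / (n : ℝ) ^ 3 * truncatedWeight p n l) := fun l => calc
    _ ≤ |γ m| * (A * (1 + |(l : ℝ)|) ^ (p - 1)) := by gcongr; exact hG l
    _ = A * (|γ m| * (1 + |(l : ℝ)|) ^ (p - 1)) := by ring
    _ ≤ _ := mul_le_mul_of_nonneg_left (abs_mul_rpow_le_of_lt_two_mul hp1 hC hn hm l) hA
  have hcut : truncatedWeight p n n = 0 := Set.indicator_of_notMem (by simp) _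
  have hfar_n := hfar n
  rw [hcut] at hfar_n
  have htri : |G (n + m) + G (n - m) - 2 * G n| ≤ |G (n + m)| + |G (n - m)| + 2 * |G n| := by
    refine (abs_sub _ _).trans ?_
    rw [abs_mul, abs_two]
    gcongr
    exact abs_add_le _ _
  calc |γ m| * (|G (n + m) + G (n - m) - 2 * G n| / 2)
      ≤ |γ m| * ((|G (n + m)| + |G (n - m)| + 2 * |G n|) / 2) := by gcongr
    _ = (|γ m| * |G (n + m)| + |γ m| * |G (n - m)| + 2 * (|γ m| * |G n|)) / 2 := by ring
    _ ≤ _ := by linear_combination (hfar (n + m) + hfar (n - m)) / 2 + hfar_n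

lemma abs_mul_second_difference_le (hp1 : p ≤ 1) (hC : ∀ m : ℤ, |(m : ℝ)| ^ 3 * |γ m| ≤ C)
    (hG : ∀ l, |G l| ≤ A * (1 + |(l : ℝ)|) ^ (p - 1))
    (hΔ : ∀ (n : ℕ) (m : ℤ), 2 * |(m : ℝ)| ≤ n →
      |G (n + m) + G (n - m) - 2 * G n| ≤ E * |(m : ℝ)| ^ 2 * (n : ℝ) ^ (p - 3))
    {n : ℕ} (hn : 1 ≤ n) (m : ℤ) :
    |γ m * ((G (n + m) + G (n - m) - 2 * G n) / 2)| ≤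
      (E / 2 + 8 * A) * (n : ℝ) ^ (p - 3) * (|(m : ℝ)| ^ 2 * |γ m|) +
        4 * A * C / (n : ℝ) ^ 3 * (truncatedWeight p n (n + m) + truncatedWeight p n (n - m)) := by
  have hA : 0 ≤ A := by simpa using (abs_nonneg _).trans (hG 0)
  have hE : 0 ≤ E := by
    have hK : (0 : ℝ) < 2 ^ (p - 3) := by positivity
    have h := (abs_nonneg _).trans (hΔ 2 1 (by norm_num))
    simpa [mul_nonneg_iff_of_pos_right hK] using h
  rw [abs_mul, abs_div, abs_two]
  rcases le_or_gt (2 * |(m : ℝ)|) n with hm | hm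
  · have hC0 : 0 ≤ C := (by positivity : (0 : ℝ) ≤ |((0 : ℤ) : ℝ)| ^ 3 * |γ 0|).trans (hC 0)
    have hw := add_nonneg (truncatedWeight_nonneg p n (n + m)) (truncatedWeight_nonneg p n (n - m))
    calc |γ m| * (|G (n + m) + G (n - m) - 2 * G n| / 2)
        ≤ |γ m| * (E * |(m : ℝ)| ^ 2 * (n : ℝ) ^ (p - 3) / 2) := by gcongr; exact hΔ n m hm
      _ = E / 2 * (n : ℝ) ^ (p - 3) * (|(m : ℝ)| ^ 2 * |γ m|) + 0 := by ring
      _ ≤ _ := by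
        gcongr
        · linarith
        · exact mul_nonneg (by positivity) hw
  · refine (abs_mul_second_difference_le_of_lt_two_mul hp1 hC hG hn hm).trans ?_
    gcongr
    linarith

theorem exists_abs_tsum_mul_sub_le (hp : 0 < p) (hp1 : p ≤ 1) (heven : Function.Even γ)
    (hC : ∀ m : ℤ, |(m : ℝ)| ^ 3 * |γ m| ≤ C)
    (hγ2 : Summable fun m : ℤ => |(m : ℝ)| ^ 2 * |γ m|)
    (hG : ∀ l, |G l| ≤ A * (1 + |(l : ℝ)|) ^ (p - 1))
    (hΔ : ∀ (n : ℕ) (m : ℤ), 2 * |(m : ℝ)| ≤ n →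
      |G (n + m) + G (n - m) - 2 * G n| ≤ E * |(m : ℝ)| ^ 2 * (n : ℝ) ^ (p - 3)) :
    ∃ B, ∀ n : ℕ, 1 ≤ n →
      |∑' m, γ m * G (n - m) - (∑' m, γ m) * G n| ≤ B * (n : ℝ) ^ (p - 3) := by
  refine ⟨(E / 2 + 8 * A) * ∑' m : ℤ, |(m : ℝ)| ^ 2 * |γ m| + 16 * A * C / p, fun n hn => ?_⟩
  have hn0 : (0 : ℝ) < n := by exact_mod_cast hn
  have hA : 0 ≤ A := by simpa using (abs_nonneg _).trans (hG 0)
  have hC0 : 0 ≤ C := (by positivity : (0 : ℝ) ≤ |((0 : ℤ) : ℝ)| ^ 3 * |γ 0|).trans (hC 0)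
  have hGA : ∀ l, |G l| ≤ A := fun l => (hG l).trans <| mul_le_of_le_one_right hA <|
    Real.rpow_le_one_of_one_le_of_nonpos (by simp) (by linarith)
  have hbound := tsum_of_norm_bounded
    ((hγ2.hasSum.mul_left ((E / 2 + 8 * A) * (n : ℝ) ^ (p - 3))).add
      (((hasSum_truncatedWeight_add p n n).add (hasSum_truncatedWeight_sub p n n)).mul_left
        (4 * A * C / (n : ℝ) ^ 3)))
    fun m => (Real.norm_eq_abs _).trans_le (abs_mul_second_difference_le hp1 hC hG hΔ hn m)
  rw [← tsum_mul_sub_sub_tsum_mul heven (summable_abs_of_summable_pow_mul hγ2) hGA,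
    Real.norm_eq_abs] at hbound
  have hweight := sum_Ioo_one_add_abs_rpow_le hp hp1 n
  calc _ ≤ _ := hbound
    _ ≤ (E / 2 + 8 * A) * (n : ℝ) ^ (p - 3) * ∑' m : ℤ, |(m : ℝ)| ^ 2 * |γ m| +
        4 * A * C / (n : ℝ) ^ 3 * (2 / p * (n : ℝ) ^ p + 2 / p * (n : ℝ) ^ p) := by gcongr
    _ = _ := by
      rw [show p - 3 = p - (3 : ℕ) by norm_num, Real.rpow_sub_natCast hn0.ne']
      ring

end Convolution

section ArfimaConvolution

variable {d C : ℝ} {γ : ℤ → ℝ}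

lemma exists_abs_arfimaACVF_le_one_add_rpow (hd : 0 < d) (hd1 : d < 1 / 2) :
    ∃ A, ∀ l : ℤ, |arfimaACVF d (|(l : ℝ)|)| ≤ A * (1 + |(l : ℝ)|) ^ (2 * d - 1) := by
  refine ⟨max |arfimaACVF d 0| (arfimaConst d * 2 ^ (1 - 2 * d)), fun l => ?_⟩
  rcases eq_or_ne l 0 with rfl | hl
  · simp
  have hl1 : (1 : ℝ) ≤ |(l : ℝ)| := by exact_mod_cast Int.one_le_abs hl
  have hl0 : 0 < |(l : ℝ)| := by linarith
  have hconst : 0 ≤ arfimaConst d := nonneg_of_mul_nonneg_left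
    ((abs_nonneg _).trans (abs_arfimaACVF_le hd hd1 hl0)) (by positivity)
  calc |arfimaACVF d (|(l : ℝ)|)| ≤ arfimaConst d * |(l : ℝ)| ^ (2 * d - 1) :=
        abs_arfimaACVF_le hd hd1 hl0
    _ = arfimaConst d * 2 ^ (1 - 2 * d) * (2 * |(l : ℝ)|) ^ (2 * d - 1) := by
        have hcancel : (2 : ℝ) ^ (1 - 2 * d) * 2 ^ (2 * d - 1) = 1 := by
          rw [← Real.rpow_add two_pos, sub_add_sub_cancel, sub_self, Real.rpow_zero]
        rw [Real.mul_rpow two_pos.le hl0.le]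
        linear_combination -arfimaConst d * |(l : ℝ)| ^ (2 * d - 1) * hcancel
    _ ≤ arfimaConst d * 2 ^ (1 - 2 * d) * (1 + |(l : ℝ)|) ^ (2 * d - 1) := by
        gcongr ?_ * ?_
        exact Real.rpow_le_rpow_of_nonpos (by linarith) (by linarith) (by linarith)
    _ ≤ _ := by gcongr; exact le_max_right _ _

lemma exists_abs_arfimaACVF_int_second_difference_le (hd : 0 < d) (hd1 : d < 1 / 2) :
    ∃ E, ∀ (n : ℕ) (m : ℤ), 2 * |(m : ℝ)| ≤ n →
      |arfimaACVF d |((n + m : ℤ) : ℝ)| + arfimaACVF d |((n - m : ℤ) : ℝ)| -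
        2 * arfimaACVF d (|((n : ℤ) : ℝ)|)| ≤ E * |(m : ℝ)| ^ 2 * (n : ℝ) ^ (2 * d - 3) := by
  obtain ⟨E, hE⟩ := exists_abs_arfimaACVF_second_difference_le hd hd1
  refine ⟨E * 2 ^ (3 - 2 * d), fun n m hm => ?_⟩
  rcases n.eq_zero_or_pos with rfl | hn
  · obtain rfl : m = 0 := by
      have habs : |(m : ℝ)| ≤ 0 := by push_cast at hm; linarith
      exact_mod_cast abs_nonpos_iff.1 habs
    simp [two_mul]
  have hn0 : (0 : ℝ) < n := by exact_mod_cast hn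
  have hE0 : 0 ≤ E := by
    simpa [show (2 : ℝ) - 1 = 1 by norm_num] using
      (abs_nonneg _).trans (hE 2 1 zero_le_one one_lt_two)
  have hreflect : arfimaACVF d |((n + m : ℤ) : ℝ)| + arfimaACVF d |((n - m : ℤ) : ℝ)| =
      arfimaACVF d (n + |(m : ℝ)|) + arfimaACVF d (n - |(m : ℝ)|) := by
    push_cast
    rw [abs_of_nonneg (by linarith [neg_abs_le (m : ℝ)] : (0 : ℝ) ≤ n + m),
      abs_of_nonneg (by linarith [le_abs_self (m : ℝ)] : (0 : ℝ) ≤ n - m)]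
    rcases abs_choice (m : ℝ) with h | h <;> rw [h]
    rw [sub_neg_eq_add, ← sub_eq_add_neg, add_comm]
  rw [hreflect, Int.cast_natCast, Nat.abs_cast]
  calc _ ≤ E * |(m : ℝ)| ^ 2 * (n - |(m : ℝ)|) ^ (2 * d - 3) :=
        hE n |(m : ℝ)| (abs_nonneg _) (by linarith)
    _ ≤ E * |(m : ℝ)| ^ 2 * ((n : ℝ) / 2) ^ (2 * d - 3) := by
        gcongr ?_ * ?_
        exact Real.rpow_le_rpow_of_nonpos (by positivity) (by linarith) (by linarith)
    _ = _ := by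
        rw [Real.div_rpow hn0.le two_pos.le, div_eq_mul_inv, ← Real.rpow_neg two_pos.le, neg_sub]
        ring

theorem exists_abs_tsum_mul_arfimaACVF_sub_le (hd : 0 < d) (hd1 : d < 1 / 2)
    (heven : Function.Even γ) (hC : ∀ m : ℤ, |(m : ℝ)| ^ 3 * |γ m| ≤ C)
    (hγ2 : Summable fun m : ℤ => |(m : ℝ)| ^ 2 * |γ m|) :
    ∃ B, ∀ n : ℕ, 1 ≤ n →
      |∑' m, γ m * arfimaACVF d |((n - m : ℤ) : ℝ)| -
        (∑' m, γ m) * (arfimaConst d * (n : ℝ) ^ (2 * d - 1))| ≤ B * (n : ℝ) ^ (2 * d - 3) := by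
  obtain ⟨A, hA⟩ := exists_abs_arfimaACVF_le_one_add_rpow hd hd1
  obtain ⟨E, hE⟩ := exists_abs_arfimaACVF_int_second_difference_le hd hd1
  obtain ⟨D, hD⟩ := exists_abs_arfimaACVF_sub_le hd hd1
  obtain ⟨B, hB⟩ := exists_abs_tsum_mul_sub_le (by linarith) (by linarith) heven hC hγ2 hA hE
  refine ⟨B + |∑' m, γ m| * D, fun n hn => ?_⟩
  have hconv := hB n hn
  rw [Int.cast_natCast, Nat.abs_cast] at hconv
  calc _ ≤ |∑' m, γ m * arfimaACVF d |((n - m : ℤ) : ℝ)| - (∑' m, γ m) * arfimaACVF d n| +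
        |(∑' m, γ m) * arfimaACVF d n - (∑' m, γ m) * (arfimaConst d * (n : ℝ) ^ (2 * d - 1))| :=
        abs_sub_le _ _ _
    _ ≤ B * (n : ℝ) ^ (2 * d - 3) + |∑' m, γ m| * (D * (n : ℝ) ^ (2 * d - 3)) := by
        rw [← mul_sub, abs_mul]
        gcongr
        exact hD n (by exact_mod_cast hn)
    _ = _ := by ring

end ArfimaConvolution

section FractionalGaussianNoise

variable {H V : ℝ}

lemma isBigO_one_add_rpow_second_difference (s : ℝ) :
    (fun y : ℝ => (1 + y) ^ s + (1 - y) ^ s - 2 - s * (s - 1) * y ^ 2) =O[𝓝 0]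
      fun y => y ^ 4 := by
  have hplus := (Real.one_add_rpow_hasFPowerSeriesAt_zero (a := s)).isBigO_sub_partialSum_pow 4
  have hneg : Tendsto (fun y : ℝ => -y) (𝓝 0) (𝓝 0) := by
    simpa using (continuous_neg (G := ℝ)).tendsto 0
  have hminus := (hplus.comp_tendsto hneg).trans
    (by simpa [Function.comp_def] using isBigO_refl _ _)
  have hchoose : Ring.choose s 2 = s * (s - 1) / 2 := by
    have h := Ring.descPochhammer_eq_factorial_smul_choose s 2
    rw [← Polynomial.aeval_eq_smeval] at h
    simp only [descPochhammer_succ_right, descPochhammer_zero, CharP.cast_eq_zero, sub_zero,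
      one_mul, Nat.cast_one, map_mul, Polynomial.aeval_X, Polynomial.aeval_sub, map_one,
      Nat.factorial_two, nsmul_eq_mul, Nat.cast_ofNat] at h
    linarith
  refine ((hplus.add hminus).congr_left fun y => ?_).trans ?_
  · simp only [FormalMultilinearSeries.partialSum, binomialSeries,
      FormalMultilinearSeries.apply_eq_prod_smul_coeff, Finset.prod_const, Finset.card_univ,
      Fintype.card_fin, FormalMultilinearSeries.coeff_ofScalars, smul_eq_mul, Finset.sum_range_succ,
      Finset.range_zero, Finset.sum_empty, Ring.choose_zero_right', Ring.choose_one_right', hchoose,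
      Function.comp_apply, zero_add, ← sub_eq_add_neg]
    ring
  · simp_rw [← norm_pow]
    exact (isBigO_refl _ _).norm_left

lemma fgnACVF_eq_rpow_mul (H V : ℝ) {n : ℕ} (hn : 1 ≤ n) :
    fgnACVF H V n = V / 2 * ((n : ℝ) ^ (2 * H) *
      ((1 + (n : ℝ)⁻¹) ^ (2 * H) + (1 - (n : ℝ)⁻¹) ^ (2 * H) - 2)) := by
  have hn1 : (1 : ℝ) ≤ n := by exact_mod_cast hn
  have hn0 : (0 : ℝ) < n := by linarith
  have hinv : 0 ≤ 1 - (n : ℝ)⁻¹ := sub_nonneg.mpr (inv_le_one_of_one_le₀ hn1)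
  rw [fgnACVF, Int.cast_natCast, Nat.abs_cast, abs_of_pos (by positivity : (0 : ℝ) < n + 1),
    abs_of_nonneg (by linarith : (0 : ℝ) ≤ n - 1),
    show (n : ℝ) + 1 = n * (1 + (n : ℝ)⁻¹) by field_simp,
    show (n : ℝ) - 1 = n * (1 - (n : ℝ)⁻¹) by field_simp,
    Real.mul_rpow hn0.le (by positivity), Real.mul_rpow hn0.le hinv]
  ring

theorem fgnACVF_sub_isBigO (H V : ℝ) :
    (fun n : ℕ => fgnACVF H V n - V * H * (2 * H - 1) * (n : ℝ) ^ (2 * H - 2)) =O[atTop]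
      fun n : ℕ => (n : ℝ) ^ (2 * H - 4) := by
  have hdiff := (isBigO_one_add_rpow_second_difference (2 * H)).comp_tendsto
    (tendsto_inv_atTop_nhds_zero_nat (𝕜 := ℝ))
  have hscaled := (isBigO_refl (fun n : ℕ => V / 2 * (n : ℝ) ^ (2 * H)) atTop).mul hdiff
  refine (hscaled.congr' ?_ ?_).trans (isBigO_const_mul_self (V / 2) _ _)
  · filter_upwards [eventually_ge_atTop 1] with n hn
    have hn0 : (n : ℝ) ≠ 0 := by positivity
    simp only [Function.comp_apply]
    rw [fgnACVF_eq_rpow_mul H V hn, show 2 * H - 2 = 2 * H - (2 : ℕ) by push_cast; ring,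
      Real.rpow_sub_natCast hn0]
    ring
  · filter_upwards [eventually_ge_atTop 1] with n hn
    have hn0 : (n : ℝ) ≠ 0 := by positivity
    simp only [Function.comp_apply]
    rw [show 2 * H - 4 = 2 * H - (4 : ℕ) by push_cast; ring, Real.rpow_sub_natCast hn0]
    ring

lemma eq_of_cf_eq_cfStar {h : ℝ → ℝ} (hc : cf H h = cfStar H V) :
    h 0 = 2 * V * H * Real.Gamma (2 * H) * Real.sin (H * Real.pi) := by
  have hpow : (2 * Real.pi) ^ (1 - 2 * H) ≠ 0 := by positivity
  rw [cf, cfStar, show 2 - 2 * H = 1 - 2 * H + 1 by ring,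
    Real.rpow_add_one (by positivity : 2 * Real.pi ≠ 0)] at hc
  apply mul_left_cancel₀ hpow
  rw [hc]
  field_simp

lemma two_mul_gamma_mul_sin_mul_arfimaConst (hH : H ∈ Set.Ioo (1 / 2 : ℝ) 1) :
    2 * Real.Gamma (2 * H) * Real.sin (H * Real.pi) * arfimaConst (H - 1 / 2) = 2 * H - 1 := by
  have hsin1 : Real.sin (Real.pi * (H - 1 / 2)) = -Real.cos (H * Real.pi) := by
    rw [show Real.pi * (H - 1 / 2) = H * Real.pi - Real.pi / 2 by ring, Real.sin_sub_pi_div_two]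
  have hsin2 : Real.sin (Real.pi * (2 * H - 1)) =
      -(2 * Real.sin (H * Real.pi) * Real.cos (H * Real.pi)) := by
    rw [show Real.pi * (2 * H - 1) = 2 * (H * Real.pi) - Real.pi by ring, Real.sin_sub_pi,
      Real.sin_two_mul]
  have hsin_pos : 0 < Real.sin (Real.pi * (2 * H - 1)) :=
    Real.sin_pos_of_pos_of_lt_pi (by nlinarith [hH.1, Real.pi_pos])
      (by nlinarith [hH.2, Real.pi_pos])
  have hreflect := Real.Gamma_mul_Gamma_one_sub (2 * H - 1)
  rw [eq_div_iff hsin_pos.ne', hsin2] at hreflect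
  have hGamma : Real.Gamma (2 * H) = (2 * H - 1) * Real.Gamma (2 * H - 1) := by
    rw [← Real.Gamma_add_one (by linarith [hH.1]), sub_add_cancel]
  rw [arfimaConst, Real.Gamma_mul_Gamma_one_sub (H - 1 / 2), hsin1, hGamma,
    show 1 - 2 * (H - 1 / 2) = 1 - (2 * H - 1) by ring, inv_div]
  calc _ = (2 * H - 1) * (Real.Gamma (2 * H - 1) * Real.Gamma (1 - (2 * H - 1)) *
        -(2 * Real.sin (H * Real.pi) * Real.cos (H * Real.pi))) / Real.pi := by ring
    _ = 2 * H - 1 := by rw [hreflect, mul_div_cancel_right₀ _ Real.pi_ne_zero]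

lemma mul_arfimaConst_eq (hH : H ∈ Set.Ioo (1 / 2 : ℝ) 1) {h : ℝ → ℝ}
    (hc : cf H h = cfStar H V) :
    h 0 * arfimaConst (H - 1 / 2) = V * H * (2 * H - 1) := by
  rw [eq_of_cf_eq_cfStar hc]
  linear_combination V * H * two_mul_gamma_mul_sin_mul_arfimaConst hH

end FractionalGaussianNoise

end FracDiff

theorem mainTheorem4_general {Ω : Type*} [MeasurableSpace Ω] (P : Measure Ω)
    [IsProbabilityMeasure P] (H : ℝ) (hH : H ∈ Set.Ioo (1 / 2 : ℝ) 1)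
    (h : ℝ → ℝ)
    (h_smooth : ContDiffOn ℝ 3 h (Set.Icc (-1 / 2 : ℝ) (1 / 2)))
    (h_match : derivWithin h (Set.Icc (-1 / 2 : ℝ) (1 / 2)) (-1 / 2) =
      derivWithin h (Set.Icc (-1 / 2 : ℝ) (1 / 2)) (1 / 2))
    (Y X : ℤ → Ω → ℝ)
    (hY : FracDiff.SecondOrderStationary Y P)
    (hYh : FracDiff.HasSpectralDensity (FracDiff.acvf Y P) h)
    (hX : FracDiff.IsFractionalDifference (-(H - 1 / 2)) Y X P)
    (V : ℝ) (hc : FracDiff.cf H h = FracDiff.cfStar H V) :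
    FracDiff.SecondOrderStationary X P ∧
      (fun n : ℕ => FracDiff.acvf X P n - FracDiff.fgnACVF H V n) =O[atTop]
        (fun n : ℕ => (n : ℝ) ^ (2 * H - 4)) := by
  have hd : 0 < H - 1 / 2 := by linarith [hH.1]
  have hd1 : H - 1 / 2 < 1 / 2 := by linarith [hH.2]
  have hdecay := hYh.summable_sq_cube_mul_abs h_smooth h_match
  have hmoment := FracDiff.summable_pow_mul_abs_of_sq hdecay
  have hsum := FracDiff.summable_abs_of_summable_pow_mul hmoment
  obtain ⟨C, hC⟩ := FracDiff.exists_abs_le_of_summable_sq hdecay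
  obtain ⟨B, hB⟩ := FracDiff.exists_abs_tsum_mul_arfimaACVF_sub_le hd hd1 hYh.acvf_neg
    (fun m => (le_abs_self _).trans (hC m)) hmoment
  have hXasymp : (fun n : ℕ => FracDiff.acvf X P n -
      V * H * (2 * H - 1) * (n : ℝ) ^ (2 * H - 2)) =O[atTop]
        fun n : ℕ => (n : ℝ) ^ (2 * H - 4) := by
    refine IsBigO.of_bound B ((eventually_ge_atTop 1).mono fun n hn => ?_)
    have hbound := hB n hn
    rw [← hX.acvf_eq_tsum hY hd hd1 hsum,
      (hYh.hasSum h_smooth.continuousOn hsum.of_abs).tsum_eq, ← mul_assoc,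
      FracDiff.mul_arfimaConst_eq hH hc, show 2 * (H - 1 / 2) - 1 = 2 * H - 2 by ring,
      show 2 * (H - 1 / 2) - 3 = 2 * H - 4 by ring] at hbound
    rwa [Real.norm_eq_abs, Real.norm_of_nonneg (by positivity)]
  exact ⟨hX.secondOrderStationary hY,
    (hXasymp.sub (FracDiff.fgnACVF_sub_isBigO H V)).congr_left fun n => sub_sub_sub_cancel_right ..⟩

theorem mainTheorem4 {Ω : Type*} [MeasurableSpace Ω] (P : Measure Ω) [IsProbabilityMeasure P]
    (H : ℝ) (hH : H ∈ Set.Ioo (1 / 2 : ℝ) 1)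
    (h : ℝ → ℝ)
    (h_pos : ∀ x ∈ Set.Icc (-1 / 2 : ℝ) (1 / 2), 0 < h x)
    (h_smooth : ContDiffOn ℝ 3 h (Set.Icc (-1 / 2 : ℝ) (1 / 2)))
    (h_match : derivWithin h (Set.Icc (-1 / 2 : ℝ) (1 / 2)) (-1 / 2) =
      derivWithin h (Set.Icc (-1 / 2 : ℝ) (1 / 2)) (1 / 2))
    (Y X : ℤ → Ω → ℝ)
    (hY : FracDiff.SecondOrderStationary Y P)
    (hYh : FracDiff.HasSpectralDensity (FracDiff.acvf Y P) h)
    (hX : FracDiff.IsFractionalDifference (-(H - 1 / 2)) Y X P)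
    (V : ℝ) (hV : 0 < V) (hc : FracDiff.cf H h = FracDiff.cfStar H V) :
    FracDiff.SecondOrderStationary X P ∧
      (fun n : ℕ => FracDiff.acvf X P n - FracDiff.fgnACVF H V n) =O[atTop]
        (fun n : ℕ => (n : ℝ) ^ (2 * H - 4)) := by
  exact mainTheorem4_general P H hH h h_smooth h_match Y X hY hYh hX V hc
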